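/- **Setting.** Let $(M,\varphi,\xi,\eta,g)$ be an almost contact metric manifold of dimension $2n+1$: $M$ is a smooth manifold without boundary, $g$ a Riemannian metric, and $\varphi$ (a $(1,1)$-tensor field), $\xi$ (a vector field), $\eta$ (a $1$-form) are smooth with $\varphi^2=-I+\eta\otimes\xi$, $\eta(\xi)=1$, $g(\varphi X,\varphi Y)=g(X,Y)-\eta(X)\eta(Y)$. Let $\nabla$ be the Levi-Civita connection, $\mathcal H=\ker\eta$, $\Phi(X,Y)=g(X,\varphi Y)$, and $$S=\varphi\circ\nabla\xi,\qquad h=\tfrac12\mathcal L_\xi\varphi,\qquad P=-2h+\varphi S\varphi+S .$$ $M$ is *$\mathcal H$-parallel* if $(\nabla_X\Phi)(Y,Z)=0$ for all $X,Y,Z\in\mathcal H$. We write $S\in S^2\mathcal H^*$ (resp. $S\in\Lambda^2\mathcal H^*$) if $S$ is a symmetric (resp. skew-symmetric) endomorphism of $\mathcal H$, that is, $S\xi=0$, $\eta\circ S=0$ and $S|_{\mathcal H}$ is symmetric (resp. skew-symmetric). **Classes.** For $x\in M$ let $\mathcal C(T_xM)$ be the space of $(0,3)$-tensors $\alpha$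 on $T_xM$ with $\alpha(X,Y,Z)=-\alpha(X,Z,Y)=-\alpha(X,\varphi Y,\varphi Z)+\eta(Y)\alpha(X,\xi,Z)+\eta(Z)\alpha(X,Y,\xi)$ and inner product $\langle\alpha,\beta\rangle=\sum_{i,j,k}\alpha(e_i,e_j,e_k)\beta(e_i,e_j,e_k)$, for an orthonormal basis $(e_i)$. For $\alpha\in\mathcal C(T_xM)$ put $\alpha_\eta(X,Y)=\alpha(X,\xi,\varphi Y)$, $\delta_\eta(\alpha)=-\sum_i\alpha_\eta(e_i,e_i)$, $\delta_\Phi(\alpha)(Z)=-\sum_i\alpha(e_i,e_i,Z)$; for $\alpha=\nabla\Phi$ these are $\nabla\eta$, $\delta\eta$, $\delta\Phi$. The Chinea–Gonzalez classes $\mathcal C_5,\dots,\mathcal C_{12}$ are the subspaces of $\mathcal C(T_xM)$ given by $\alpha(X,Y,Z)=\dots$ for all $X,Y,Z$, as follows: - $\mathcal C_5$: $\frac1{2n}[\eta(Y)\Phi(X,Z)-\eta(Z)\Phi(X,Y)]\,\delta_\eta(\alpha)$; - $\mathcal C_6$: $\frac1{2n}[\eta(Y)g(X,Z)-\eta(Z)g(X,Y)]\,\delta_\Phi(\alpha)(\xi)$;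 - $\mathcal C_7$: $\eta(Z)\alpha_\eta(Y,\varphi X)+\eta(Y)\alpha_\eta(\varphi X,Z)$, and $\delta_\Phi(\alpha)=0$; - $\mathcal C_8$: $-\eta(Z)\alpha_\eta(Y,\varphi X)+\eta(Y)\alpha_\eta(\varphi X,Z)$, and $\delta_\eta(\alpha)=0$; - $\mathcal C_9$: $\eta(Z)\alpha_\eta(Y,\varphi X)-\eta(Y)\alpha_\eta(\varphi X,Z)$; - $\mathcal C_{10}$: $-\eta(Z)\alpha_\eta(Y,\varphi X)-\eta(Y)\alpha_\eta(\varphi X,Z)$; - $\mathcal C_{11}$: $-\eta(X)\alpha(\xi,\varphi Y,\varphi Z)$; - $\mathcal C_{12}$: $\eta(X)\eta(Z)\alpha_\eta(\xi,\varphi Y)-\eta(X)\eta(Y)\alpha_\eta(\xi,\varphi Z)$. Put $\mathcal D_2=\mathcal C_5\oplus\dots\oplus\mathcal C_{11}$ and $\mathcal D_3=\mathcal C_{12}$. $M$ *is of class $U$* if $(\nabla\Phi)_x\in U_x$ at every $x\in M$. In dimension $1$ ($n=0$) the factor $\frac1{2n}$ is read as $0$. **Theorem.** The subspaces $\mathcal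 C_5,\dots,\mathcal C_{12}$ are mutually orthogonal, and $M$ is $\mathcal H$-parallel if and only if it is of class $\mathcal D_2\oplus\mathcal D_3$. If $M$ is $\mathcal H$-parallel, the following hold, all conditions on $S,h,P$ being required on all of $M$. 1. $M$ is of class $\mathcal D_3=\mathcal C_{12}$ iff $S|_{\mathcal H}=0$ and $\varphi h=0$; $M$ is of class $\mathcal D_2$ iff $S\xi=0$. 2. If $M$ is of class $\mathcal D_2$: it is of class $\mathcal C_{11}$ iff $S=0$; it is of class $\mathcal C_5\oplus\dots\oplus\mathcal C_{10}$ iff $P=0$, equivalently iff $2h=S+\varphi S\varphi$. 3. If $M$ is of class $\mathcal C_5\oplus\dots\oplus\mathcal C_{10}$: it is of class $\mathcal C_9\oplus\mathcal C_{10}$ iff $S\varphi+\varphi S=0$, equivalently iff $h=S$; it is of class $\mathcal C_5\oplus\dots\oplus\mathcal C_8$ iff $S\varphi-\varphi S=0$, equivalently iff $h=0$. 4. If $M$ is of class $\mathcal C_9\oplus\mathcal C_{10}$: it is of class $\mathcal C_{10}$ iff $S\in\Lambda^2\mathcal H^*$, and of class $\mathcal C_9$ iff $S\in S^2\mathcal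 H^*$. 5. If $M$ is of class $\mathcal C_5\oplus\dots\oplus\mathcal C_8$: it is of class $\mathcal C_5\oplus\mathcal C_8$ iff $S\in\Lambda^2\mathcal H^*$, and of class $\mathcal C_6\oplus\mathcal C_7$ iff $S\in S^2\mathcal H^*$. 6. If $M$ is of class $\mathcal C_5\oplus\mathcal C_8$: it is of class $\mathcal C_8$ iff $\operatorname{tr}(\varphi S)=0$, and of class $\mathcal C_5$ iff $S=\beta\varphi$ with $\beta=-\frac1{2n}\operatorname{tr}(\varphi S)$. 7. If $M$ is of class $\mathcal C_6\oplus\mathcal C_7$: it is of class $\mathcal C_6$ iff $S=\alpha(I-\eta\otimes\xi)$ with $\alpha=\frac1{2n}\operatorname{tr}(S)$, and of class $\mathcal C_7$ iff $\operatorname{tr}(S)=0$. 8. $M$ is of class $\mathcal C_5\oplus\dots\oplus\mathcal C_8$ iff it is normal ($[\varphi,\varphi]+d\eta\otimes\xi=0$); of class $\mathcal C_9$ iff it is almost cokähler ($d\eta=0$, $d\Phi=0$); of class $\mathcal C_6\oplus\mathcal C_7$ iff it is quasi-Sasakian (normal, $d\Phi=0$); of class $\mathcal C_5$ iff it is $\beta$-Kenmotsu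 (normal, $d\eta=0$, $d\Phi=2\beta\,\eta\wedge\Phi$ for some function $\beta$); of class $\mathcal C_6$ iff it is $\alpha$-Sasakian (quasi-Sasakian, $d\eta=2\alpha\Phi$ for some function $\alpha$). Here $d\eta(X,Y)=X(\eta(Y))-Y(\eta(X))-\eta([X,Y])$, and correspondingly for $d\Phi$. 9. Among all $\mathcal H$-parallel manifolds, $M$ is of class - $\mathcal C_5$ iff $h=0$ and $S=\beta\varphi$ with $\beta=-\frac1{2n}\operatorname{tr}(\varphi S)$; - $\mathcal C_6$ iff $h=0$ and $S=\alpha(I-\eta\otimes\xi)$ with $\alpha=\frac1{2n}\delta\Phi(\xi)$; - $\mathcal C_7$ iff $h=0$, $S\in S^2\mathcal H^*$, $S\varphi=\varphi S$ and $\operatorname{tr}(S)=0$; - $\mathcal C_8$ iff $h=0$, $S\in\Lambda^2\mathcal H^*$, $S\varphi=\varphi S$ and $\operatorname{tr}(\varphi S)=0$; - $\mathcal C_9$ iff $h=S$, $S\in S^2\mathcal H^*$ and $S\varphi=-\varphi S$; - $\mathcal C_{10}$ iff $h=S$, $S\in\Lambda^2\mathcal H^*$ and $S\varphi=-\varphi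 S$; - $\mathcal C_{11}$ iff $S=0$; - $\mathcal C_{12}$ iff $S|_{\mathcal H}=0$ and $\varphi h=0$. -/

import Mathlib

set_option linter.unusedSectionVars false
set_option linter.unusedSimpArgs false

open Bundle Manifold VectorField
open scoped ContDiff

namespace ACM

noncomputable section

/-! ### Linear algebra: the Chinea-Gonzalez classes of a vector space -/

section Linear

/-- An almost contact metric structure `(φ, ξ, η, ⟨·,·⟩)` on a Euclidean vector space `V`. -/
structure LinearStructure (V : Type*) [NormedAddCommGroup V] [InnerProductSpace ℝ V] where
  φ : V →ₗ[ℝ] V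
  ξ : V
  η : V →ₗ[ℝ] ℝ
  φ_sq : ∀ X, φ (φ X) = -X + η X • ξ
  η_ξ : η ξ = 1
  inner_φ : ∀ X Y, inner ℝ (φ X) (φ Y) = inner ℝ X Y - η X * η Y

/-- Tensors of type `(0,3)`. -/
abbrev Tensor3 (V : Type*) [NormedAddCommGroup V] [InnerProductSpace ℝ V] : Type _ :=
  V →ₗ[ℝ] V →ₗ[ℝ] V →ₗ[ℝ] ℝ

/-- The inner product of `(0,3)`-tensors induced by that of `V`. -/
def tensorInner {V : Type*} [NormedAddCommGroup V] [InnerProductSpace ℝ V]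
    [FiniteDimensional ℝ V] (α β : Tensor3 V) : ℝ :=
  let e := stdOrthonormalBasis ℝ V
  ∑ i, ∑ j, ∑ k, α (e i) (e j) (e k) * β (e i) (e j) (e k)

namespace LinearStructure

variable {V : Type*} [NormedAddCommGroup V] [InnerProductSpace ℝ V] [FiniteDimensional ℝ V]
  (a : LinearStructure V)

/-- The fundamental form `Φ(X, Y) = ⟨X, φ Y⟩`. -/
def Phi (X Y : V) : ℝ := inner ℝ X (a.φ Y)

/-- For `α = ∇Φ` this is `(∇_X η)(Y)`, because `(∇_X η)(Y) = (∇_X Φ)(ξ, φ Y)`. -/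
def nablaEta (α : Tensor3 V) (X Y : V) : ℝ := α X a.ξ (a.φ Y)

/-- For `α = ∇Φ` this is the codifferential `δη = -∑ (∇_{e_i} η)(e_i)`. -/
def deltaEta (α : Tensor3 V) : ℝ :=
  -∑ i, a.nablaEta α (stdOrthonormalBasis ℝ V i) (stdOrthonormalBasis ℝ V i)

/-- For `α = ∇Φ` this is the codifferential `δΦ(Z) = -∑ (∇_{e_i} Φ)(e_i, Z)`. -/
def deltaPhi (_a : LinearStructure V) (α : Tensor3 V) (Z : V) : ℝ :=
  -∑ i, α (stdOrthonormalBasis ℝ V i) (stdOrthonormalBasis ℝ V i) Z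

theorem nablaEta_add (α β : Tensor3 V) (X Y : V) :
    a.nablaEta (α + β) X Y = a.nablaEta α X Y + a.nablaEta β X Y := rfl

theorem nablaEta_smul (c : ℝ) (α : Tensor3 V) (X Y : V) :
    a.nablaEta (c • α) X Y = c * a.nablaEta α X Y := rfl

theorem nablaEta_zero (X Y : V) : a.nablaEta 0 X Y = 0 := rfl

theorem deltaEta_add (α β : Tensor3 V) :
    a.deltaEta (α + β) = a.deltaEta α + a.deltaEta β := by
  simp only [deltaEta, nablaEta_add, Finset.sum_add_distrib]
  ring

theorem deltaEta_smul (c : ℝ) (α : Tensor3 V) : a.deltaEta (c • α) = c * a.deltaEta α := by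
  simp only [deltaEta, nablaEta_smul, ← Finset.mul_sum]
  ring

theorem deltaEta_zero : a.deltaEta 0 = 0 := by
  simp [deltaEta, nablaEta_zero]

theorem deltaPhi_add (α β : Tensor3 V) (Z : V) :
    a.deltaPhi (α + β) Z = a.deltaPhi α Z + a.deltaPhi β Z := by
  simp only [deltaPhi, LinearMap.add_apply, Finset.sum_add_distrib]
  ring

theorem deltaPhi_smul (c : ℝ) (α : Tensor3 V) (Z : V) :
    a.deltaPhi (c • α) Z = c * a.deltaPhi α Z := by
  simp only [deltaPhi, LinearMap.smul_apply, smul_eq_mul, ← Finset.mul_sum]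
  ring

theorem deltaPhi_zero (Z : V) : a.deltaPhi 0 Z = 0 := by
  simp [deltaPhi]

/-- The space `𝒞(V)` of `(0,3)`-tensors with the symmetries of `∇Φ`. -/
def CV : Submodule ℝ (Tensor3 V) where
  carrier := {α | ∀ X Y Z, α X Y Z = -α X Z Y ∧
    α X Y Z = -α X (a.φ Y) (a.φ Z) + a.η Y * α X a.ξ Z + a.η Z * α X Y a.ξ}
  zero_mem' := fun X Y Z ↦ by simp
  add_mem' := fun {α β} hα hβ X Y Z ↦ by
    refine ⟨?_, ?_⟩
    · simp only [LinearMap.add_apply]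
      linear_combination (hα X Y Z).1 + (hβ X Y Z).1
    · simp only [LinearMap.add_apply]
      linear_combination (hα X Y Z).2 + (hβ X Y Z).2
  smul_mem' := fun c α hα X Y Z ↦ by
    refine ⟨?_, ?_⟩
    · simp only [LinearMap.smul_apply, smul_eq_mul]
      linear_combination c * (hα X Y Z).1
    · simp only [LinearMap.smul_apply, smul_eq_mul]
      linear_combination c * (hα X Y Z).2

/-- The class `𝒞_5`. -/
def C5 (n : ℕ) : Submodule ℝ (Tensor3 V) where
  carrier := {α | α ∈ a.CV ∧
    (∀ X Y Z, α X Y Z = 1 / (2 * n) * (a.η Y * a.Phi X Z - a.η Z * a.Phi X Y) * a.deltaEta α)}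
  zero_mem' := ⟨a.CV.zero_mem, fun X Y Z ↦ by
    simp [nablaEta_zero, deltaEta_zero, deltaPhi_zero]⟩
  add_mem' := by
    rintro α β ⟨h, h1⟩ ⟨k, k1⟩
    refine ⟨a.CV.add_mem h k, fun X Y Z ↦ ?_⟩
    simp only [LinearMap.add_apply, nablaEta_add, deltaEta_add, deltaPhi_add]
    linear_combination h1 X Y Z + k1 X Y Z
  smul_mem' := by
    rintro c α ⟨h, h1⟩
    refine ⟨a.CV.smul_mem c h, fun X Y Z ↦ ?_⟩
    simp only [LinearMap.smul_apply, smul_eq_mul, nablaEta_smul, deltaEta_smul, deltaPhi_smul]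
    linear_combination c * h1 X Y Z

/-- The class `𝒞_6`. -/
def C6 (n : ℕ) : Submodule ℝ (Tensor3 V) where
  carrier := {α | α ∈ a.CV ∧
    (∀ X Y Z, α X Y Z = 1 / (2 * n) * (a.η Y * inner ℝ X Z - a.η Z * inner ℝ X Y) * a.deltaPhi α a.ξ)}
  zero_mem' := ⟨a.CV.zero_mem, fun X Y Z ↦ by
    simp [nablaEta_zero, deltaEta_zero, deltaPhi_zero]⟩
  add_mem' := by
    rintro α β ⟨h, h1⟩ ⟨k, k1⟩
    refine ⟨a.CV.add_mem h k, fun X Y Z ↦ ?_⟩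
    simp only [LinearMap.add_apply, nablaEta_add, deltaEta_add, deltaPhi_add]
    linear_combination h1 X Y Z + k1 X Y Z
  smul_mem' := by
    rintro c α ⟨h, h1⟩
    refine ⟨a.CV.smul_mem c h, fun X Y Z ↦ ?_⟩
    simp only [LinearMap.smul_apply, smul_eq_mul, nablaEta_smul, deltaEta_smul, deltaPhi_smul]
    linear_combination c * h1 X Y Z

/-- The class `𝒞_7`. -/
def C7 : Submodule ℝ (Tensor3 V) where
  carrier := {α | α ∈ a.CV ∧
    (∀ X Y Z, α X Y Z = a.η Z * a.nablaEta α Y (a.φ X) + a.η Y * a.nablaEta α (a.φ X) Z) ∧ ∀ Z, a.deltaPhi α Z = 0}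
  zero_mem' := ⟨a.CV.zero_mem, fun X Y Z ↦ by
    simp [nablaEta_zero, deltaEta_zero, deltaPhi_zero], fun Z ↦ a.deltaPhi_zero Z⟩
  add_mem' := by
    rintro α β ⟨h, h1, h2⟩ ⟨k, k1, k2⟩
    refine ⟨a.CV.add_mem h k, fun X Y Z ↦ ?_, fun Z ↦ by rw [a.deltaPhi_add, h2, k2, add_zero]⟩
    simp only [LinearMap.add_apply, nablaEta_add, deltaEta_add, deltaPhi_add]
    linear_combination h1 X Y Z + k1 X Y Z
  smul_mem' := by
    rintro c α ⟨h, h1, h2⟩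
    refine ⟨a.CV.smul_mem c h, fun X Y Z ↦ ?_, fun Z ↦ by rw [a.deltaPhi_smul, h2, mul_zero]⟩
    simp only [LinearMap.smul_apply, smul_eq_mul, nablaEta_smul, deltaEta_smul, deltaPhi_smul]
    linear_combination c * h1 X Y Z

/-- The class `𝒞_8`. -/
def C8 : Submodule ℝ (Tensor3 V) where
  carrier := {α | α ∈ a.CV ∧
    (∀ X Y Z, α X Y Z = -(a.η Z * a.nablaEta α Y (a.φ X)) + a.η Y * a.nablaEta α (a.φ X) Z) ∧ a.deltaEta α = 0}
  zero_mem' := ⟨a.CV.zero_mem, fun X Y Z ↦ by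
    simp [nablaEta_zero, deltaEta_zero, deltaPhi_zero], a.deltaEta_zero⟩
  add_mem' := by
    rintro α β ⟨h, h1, h2⟩ ⟨k, k1, k2⟩
    refine ⟨a.CV.add_mem h k, fun X Y Z ↦ ?_, by rw [a.deltaEta_add, h2, k2, add_zero]⟩
    simp only [LinearMap.add_apply, nablaEta_add, deltaEta_add, deltaPhi_add]
    linear_combination h1 X Y Z + k1 X Y Z
  smul_mem' := by
    rintro c α ⟨h, h1, h2⟩
    refine ⟨a.CV.smul_mem c h, fun X Y Z ↦ ?_, by rw [a.deltaEta_smul, h2, mul_zero]⟩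
    simp only [LinearMap.smul_apply, smul_eq_mul, nablaEta_smul, deltaEta_smul, deltaPhi_smul]
    linear_combination c * h1 X Y Z

/-- The class `𝒞_9`. -/
def C9 : Submodule ℝ (Tensor3 V) where
  carrier := {α | α ∈ a.CV ∧
    (∀ X Y Z, α X Y Z = a.η Z * a.nablaEta α Y (a.φ X) - a.η Y * a.nablaEta α (a.φ X) Z)}
  zero_mem' := ⟨a.CV.zero_mem, fun X Y Z ↦ by
    simp [nablaEta_zero, deltaEta_zero, deltaPhi_zero]⟩
  add_mem' := by
    rintro α β ⟨h, h1⟩ ⟨k, k1⟩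
    refine ⟨a.CV.add_mem h k, fun X Y Z ↦ ?_⟩
    simp only [LinearMap.add_apply, nablaEta_add, deltaEta_add, deltaPhi_add]
    linear_combination h1 X Y Z + k1 X Y Z
  smul_mem' := by
    rintro c α ⟨h, h1⟩
    refine ⟨a.CV.smul_mem c h, fun X Y Z ↦ ?_⟩
    simp only [LinearMap.smul_apply, smul_eq_mul, nablaEta_smul, deltaEta_smul, deltaPhi_smul]
    linear_combination c * h1 X Y Z

/-- The class `𝒞_10`. -/
def C10 : Submodule ℝ (Tensor3 V) where
  carrier := {α | α ∈ a.CV ∧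
    (∀ X Y Z, α X Y Z = -(a.η Z * a.nablaEta α Y (a.φ X)) - a.η Y * a.nablaEta α (a.φ X) Z)}
  zero_mem' := ⟨a.CV.zero_mem, fun X Y Z ↦ by
    simp [nablaEta_zero, deltaEta_zero, deltaPhi_zero]⟩
  add_mem' := by
    rintro α β ⟨h, h1⟩ ⟨k, k1⟩
    refine ⟨a.CV.add_mem h k, fun X Y Z ↦ ?_⟩
    simp only [LinearMap.add_apply, nablaEta_add, deltaEta_add, deltaPhi_add]
    linear_combination h1 X Y Z + k1 X Y Z
  smul_mem' := by
    rintro c α ⟨h, h1⟩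
    refine ⟨a.CV.smul_mem c h, fun X Y Z ↦ ?_⟩
    simp only [LinearMap.smul_apply, smul_eq_mul, nablaEta_smul, deltaEta_smul, deltaPhi_smul]
    linear_combination c * h1 X Y Z

/-- The class `𝒞_11`. -/
def C11 : Submodule ℝ (Tensor3 V) where
  carrier := {α | α ∈ a.CV ∧
    (∀ X Y Z, α X Y Z = -(a.η X * α a.ξ (a.φ Y) (a.φ Z)))}
  zero_mem' := ⟨a.CV.zero_mem, fun X Y Z ↦ by
    simp [nablaEta_zero, deltaEta_zero, deltaPhi_zero]⟩
  add_mem' := by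
    rintro α β ⟨h, h1⟩ ⟨k, k1⟩
    refine ⟨a.CV.add_mem h k, fun X Y Z ↦ ?_⟩
    simp only [LinearMap.add_apply, nablaEta_add, deltaEta_add, deltaPhi_add]
    linear_combination h1 X Y Z + k1 X Y Z
  smul_mem' := by
    rintro c α ⟨h, h1⟩
    refine ⟨a.CV.smul_mem c h, fun X Y Z ↦ ?_⟩
    simp only [LinearMap.smul_apply, smul_eq_mul, nablaEta_smul, deltaEta_smul, deltaPhi_smul]
    linear_combination c * h1 X Y Z

/-- The class `𝒞_12`. -/
def C12 : Submodule ℝ (Tensor3 V) where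
  carrier := {α | α ∈ a.CV ∧
    (∀ X Y Z, α X Y Z = a.η X * a.η Z * a.nablaEta α a.ξ (a.φ Y) - a.η X * a.η Y * a.nablaEta α a.ξ (a.φ Z))}
  zero_mem' := ⟨a.CV.zero_mem, fun X Y Z ↦ by
    simp [nablaEta_zero, deltaEta_zero, deltaPhi_zero]⟩
  add_mem' := by
    rintro α β ⟨h, h1⟩ ⟨k, k1⟩
    refine ⟨a.CV.add_mem h k, fun X Y Z ↦ ?_⟩
    simp only [LinearMap.add_apply, nablaEta_add, deltaEta_add, deltaPhi_add]
    linear_combination h1 X Y Z + k1 X Y Z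
  smul_mem' := by
    rintro c α ⟨h, h1⟩
    refine ⟨a.CV.smul_mem c h, fun X Y Z ↦ ?_⟩
    simp only [LinearMap.smul_apply, smul_eq_mul, nablaEta_smul, deltaEta_smul, deltaPhi_smul]
    linear_combination c * h1 X Y Z

/-- `𝒟_2 = 𝒞_5 ⊕ ⋯ ⊕ 𝒞_11`. -/
def D2 (n : ℕ) : Submodule ℝ (Tensor3 V) :=
  a.C5 n ⊔ a.C6 n ⊔ a.C7 ⊔ a.C8 ⊔ a.C9 ⊔ a.C10 ⊔ a.C11

/-- `𝒞_5 ⊕ ⋯ ⊕ 𝒞_10`. -/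
def C5to10 (n : ℕ) : Submodule ℝ (Tensor3 V) :=
  a.C5 n ⊔ a.C6 n ⊔ a.C7 ⊔ a.C8 ⊔ a.C9 ⊔ a.C10

/-- `𝒞_5 ⊕ ⋯ ⊕ 𝒞_8`. -/
def C5to8 (n : ℕ) : Submodule ℝ (Tensor3 V) :=
  a.C5 n ⊔ a.C6 n ⊔ a.C7 ⊔ a.C8

/-- `𝒟_3 = 𝒞_12`. -/
def D3 : Submodule ℝ (Tensor3 V) := a.C12

/-- `A ∈ S²ℋ*`: `A` is a symmetric endomorphism of `ℋ = ker η` (extended by `A ξ = 0`). -/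
def IsSymmOnH (A : V → V) : Prop :=
  A a.ξ = 0 ∧ (∀ X, a.η (A X) = 0) ∧
    ∀ X Y, a.η X = 0 → a.η Y = 0 → inner ℝ (A X) Y = (inner ℝ X (A Y) : ℝ)

/-- `A ∈ Λ²ℋ*`: `A` is a skew-symmetric endomorphism of `ℋ = ker η` (extended by `A ξ = 0`). -/
def IsSkewOnH (A : V → V) : Prop :=
  A a.ξ = 0 ∧ (∀ X, a.η (A X) = 0) ∧
    ∀ X Y, a.η X = 0 → a.η Y = 0 → inner ℝ (A X) Y = (-inner ℝ X (A Y) : ℝ)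

end LinearStructure

end Linear

/-! ### The Levi-Civita connection -/

section Manifold

variable {E : Type*} [NormedAddCommGroup E] [NormedSpace ℝ E] [FiniteDimensional ℝ E]
  {H : Type*} [TopologicalSpace H] {I : ModelWithCorners ℝ E H}
  {M : Type*} [TopologicalSpace M] [ChartedSpace H M] [IsManifold I ∞ M]
  [RiemannianBundle (fun x : M ↦ TangentSpace I x)]
  [IsContMDiffRiemannianBundle I ∞ E (fun x : M ↦ TangentSpace I x)]

instance tangentFiniteDimensional (x : M) : FiniteDimensional ℝ (TangentSpace I x) :=
  inferInstanceAs (FiniteDimensional ℝ E)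

theorem mdifferentiableAt_inner {x : M} {X Y : Π x : M, TangentSpace I x}
    (hX : MDiffAt (T% X) x) (hY : MDiffAt (T% Y) x) :
    MDiffAt (fun y : M ↦ (inner ℝ (X y) (Y y) : ℝ)) x :=
  MDifferentiableAt.inner_bundle (F := E) (E := fun x : M ↦ TangentSpace I x) hX hY

/-- The right-hand side of Koszul's formula for `2 ⟨∇_X Y, Z⟩` at `x`:
`X⟨Y,Z⟩ + Y⟨X,Z⟩ - Z⟨X,Y⟩ + ⟨[X,Y],Z⟩ - ⟨[X,Z],Y⟩ - ⟨[Y,Z],X⟩`. -/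
def koszul (X Y Z : Π x : M, TangentSpace I x) (x : M) : ℝ :=
  d% (fun y : M ↦ inner ℝ (Y y) (Z y)) x (X x) + d% (fun y : M ↦ inner ℝ (X y) (Z y)) x (Y x)
    - d% (fun y : M ↦ inner ℝ (X y) (Y y)) x (Z x)
    + inner ℝ (mlieBracket I X Y x) (Z x) - inner ℝ (mlieBracket I X Z x) (Y x)
    - inner ℝ (mlieBracket I Y Z x) (X x)

theorem koszul_tensorial_left {x : M} {Y Z : Π x : M, TangentSpace I x}
    (hY : MDiffAt (T% Y) x) (hZ : MDiffAt (T% Z) x) :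
    TensorialAt I E (fun X ↦ koszul X Y Z x) x where
  smul {f X} hf hX := by
    simp only [koszul, Pi.smul_apply', mlieBracket_smul_left hf hX, real_inner_smul_left, inner_add_left,
      mvfderiv_fun_mul hf (mdifferentiableAt_inner hX hZ),
      mvfderiv_fun_mul hf (mdifferentiableAt_inner hX hY), add_apply, smul_apply, real_inner_smul_right, smul_eq_mul, map_smul,
      real_inner_comm (X x)]
    ring
  add {X X'} hX hX' := by
    simp only [koszul, Pi.add_apply, mlieBracket_add_left hX hX', inner_add_left, inner_add_right,
      mvfderiv_fun_add (mdifferentiableAt_inner hX hZ) (mdifferentiableAt_inner hX' hZ),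
      mvfderiv_fun_add (mdifferentiableAt_inner hX hY) (mdifferentiableAt_inner hX' hY), map_add, add_apply]
    ring

theorem koszul_tensorial_right {x : M} {X Y : Π x : M, TangentSpace I x}
    (hX : MDiffAt (T% X) x) (hY : MDiffAt (T% Y) x) :
    TensorialAt I E (fun Z ↦ koszul X Y Z x) x where
  smul {f Z} hf hZ := by
    simp only [koszul, Pi.smul_apply', mlieBracket_smul_right hf hZ, real_inner_smul_left, inner_add_left,
      mvfderiv_fun_mul hf (mdifferentiableAt_inner hX hZ),
      mvfderiv_fun_mul hf (mdifferentiableAt_inner hY hZ), add_apply, smul_apply, real_inner_smul_right, smul_eq_mul, map_smul,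
      real_inner_comm (Z x)]
    ring
  add {Z Z'} hZ hZ' := by
    simp only [koszul, Pi.add_apply, mlieBracket_add_right hZ hZ', inner_add_left, inner_add_right,
      mvfderiv_fun_add (mdifferentiableAt_inner hX hZ) (mdifferentiableAt_inner hX hZ'),
      mvfderiv_fun_add (mdifferentiableAt_inner hY hZ) (mdifferentiableAt_inner hY hZ'), map_add, add_apply]
    ring

/-- The bilinear form `(u, w) ↦ 2 ⟨∇_u Y, w⟩` on `T_x M` given by Koszul's formula, for a vector
field `Y` that is differentiable at `x`. -/
def koszulForm (Y : Π x : M, TangentSpace I x) (x : M) (hY : MDiffAt (T% Y) x) :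
    TangentSpace I x →L[ℝ] TangentSpace I x →L[ℝ] ℝ :=
  TensorialAt.mkHom₂ (fun X Z ↦ koszul X Y Z x) x
    (fun _ hZ ↦ koszul_tensorial_left hY hZ) (fun _ hX ↦ koszul_tensorial_right hX hY)

open Classical in
/-- `u ↦ ∇_u Y` at `x`: the vector representing `1 / 2` of the Koszul form. -/
def leviCivitaFun (Y : Π x : M, TangentSpace I x) (x : M) :
    TangentSpace I x →L[ℝ] TangentSpace I x :=
  if hY : MDiffAt (T% Y) x then
    LinearMap.toContinuousLinearMap
      { toFun := fun u ↦ (1 / 2 : ℝ) •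
          (InnerProductSpace.toDual ℝ (TangentSpace I x)).symm (koszulForm Y x hY u)
        map_add' := fun u v ↦ by rw [map_add, map_add, smul_add]
        map_smul' := fun c u ↦ by
          rw [map_smul, map_smulₛₗ, smul_comm]
          rfl }
  else 0

theorem inner_leviCivitaFun {x : M} {X Y Z : Π x : M, TangentSpace I x}
    (hX : MDiffAt (T% X) x) (hY : MDiffAt (T% Y) x) (hZ : MDiffAt (T% Z) x) :
    inner ℝ (leviCivitaFun Y x (X x)) (Z x) = 1 / 2 * koszul X Y Z x := by
  have h : koszulForm Y x hY (X x) (Z x) = koszul X Y Z x :=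
    TensorialAt.mkHom₂_apply (fun _ hZ ↦ koszul_tensorial_left hY hZ)
      (fun _ hX ↦ koszul_tensorial_right hX hY) hX hZ
  rw [← h, leviCivitaFun, dif_pos hY]
  simp [real_inner_smul_left]

theorem leviCivitaFun_ext {x : M} {A B : TangentSpace I x →L[ℝ] TangentSpace I x}
    (h : ∀ X Z : Π x : M, TangentSpace I x, MDiffAt (T% X) x → MDiffAt (T% Z) x →
      inner ℝ (A (X x)) (Z x) = inner ℝ (B (X x)) (Z x)) : A = B := by
  ext u
  refine ext_inner_right ℝ fun w ↦ ?_
  simpa using h (FiberBundle.extend E u) (FiberBundle.extend E w)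
    (FiberBundle.mdifferentiableAt_extend I E u) (FiberBundle.mdifferentiableAt_extend I E w)

/-- The Levi-Civita connection of the Riemannian manifold `M`, i.e. the covariant derivative
determined by Koszul's formula `2 ⟨∇_X Y, Z⟩ = koszul X Y Z`. Argument order as for every
`CovariantDerivative`: `leviCivita Y x (X x)` is `(∇_X Y)(x)`. -/
def leviCivita : CovariantDerivative I E (fun x : M ↦ TangentSpace I x) where
  toFun := leviCivitaFun
  isCovariantDerivativeOnUniv :=
    { add := by
        intro Y Y' x hY hY' _
        refine leviCivitaFun_ext fun X Z hX hZ ↦ ?_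
        rw [inner_leviCivitaFun hX (mdifferentiableAt_add_section hY hY') hZ, add_apply,
          inner_add_left, inner_leviCivitaFun hX hY hZ, inner_leviCivitaFun hX hY' hZ]
        simp only [koszul, Pi.add_apply, mlieBracket_add_right hY hY', mlieBracket_add_left hY hY', inner_add_left, inner_add_right,
          mvfderiv_fun_add (mdifferentiableAt_inner hX hY) (mdifferentiableAt_inner hX hY'),
          mvfderiv_fun_add (mdifferentiableAt_inner hY hZ) (mdifferentiableAt_inner hY' hZ), map_add, add_apply]
        ring
      leibniz := by
        intro Y f x hY hf _
        refine leviCivitaFun_ext fun X Z hX hZ ↦ ?_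
        rw [inner_leviCivitaFun hX (hf.smul_section hY) hZ, add_apply,
          inner_add_left, smul_apply, real_inner_smul_left, inner_leviCivitaFun hX hY hZ]
        simp only [koszul, Pi.smul_apply', mlieBracket_smul_right hf hY, mlieBracket_smul_left hf hY, real_inner_smul_left, inner_add_left,
          mvfderiv_fun_mul hf (mdifferentiableAt_inner hX hY),
          mvfderiv_fun_mul hf (mdifferentiableAt_inner hY hZ), add_apply, smul_apply, real_inner_smul_right, smul_eq_mul, map_smul,
          ContinuousLinearMap.smulRight_apply, inner_add_right, real_inner_comm (X x)]
        ring_nf }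

/-- The Levi-Civita connection is torsion-free. -/
theorem leviCivita_torsion : (leviCivita (I := I) (M := M)).torsion = 0 := by
  rw [CovariantDerivative.torsion_eq_zero_iff]
  intro X Y x hX hY
  refine ext_inner_right ℝ fun w ↦ ?_
  have hZ := FiberBundle.mdifferentiableAt_extend I E w
  have h1 := inner_leviCivitaFun hX hY hZ
  have h2 := inner_leviCivitaFun hY hX hZ
  rw [FiberBundle.extend_apply_self] at h1 h2
  change inner ℝ (leviCivitaFun Y x (X x) - leviCivitaFun X x (Y x)) w = _
  rw [inner_sub_left, h1, h2]
  simp only [koszul, mlieBracket_swap_apply (V := Y) (W := X), inner_neg_left,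
    FiberBundle.extend_apply_self, real_inner_comm]
  ring

/-- The Levi-Civita connection is metric: `X⟨Y,Z⟩ = ⟨∇_X Y, Z⟩ + ⟨Y, ∇_X Z⟩`. -/
theorem leviCivita_metric {x : M} {X Y Z : Π x : M, TangentSpace I x}
    (hX : MDiffAt (T% X) x) (hY : MDiffAt (T% Y) x) (hZ : MDiffAt (T% Z) x) :
    d% (fun y : M ↦ inner ℝ (Y y) (Z y)) x (X x) =
      inner ℝ (leviCivita Y x (X x)) (Z x) + inner ℝ (Y x) (leviCivita Z x (X x)) := by
  have h1 := inner_leviCivitaFun hX hY hZ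
  have h2 := inner_leviCivitaFun hX hZ hY
  change _ = inner ℝ (leviCivitaFun Y x (X x)) (Z x) + inner ℝ (Y x) (leviCivitaFun Z x (X x))
  rw [real_inner_comm _ (Y x), h1, h2]
  simp only [koszul, mlieBracket_swap_apply (V := Z) (W := Y), inner_neg_left,
    real_inner_comm]
  ring

/-! ### Almost contact metric manifolds -/

variable (I M) in
/-- An almost contact metric structure `(φ, ξ, η, g)` on the Riemannian manifold `M` (the metric
`g` is the Riemannian metric of `M`): smooth tensor fields with `φ² = -id + η ⊗ ξ`, `η(ξ) = 1`,
`g(φX, φY) = g(X, Y) - η(X) η(Y)`. -/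
structure AlmostContactMetricStructure where
  φ : Π x : M, TangentSpace I x →L[ℝ] TangentSpace I x
  ξ : Π x : M, TangentSpace I x
  η : Π x : M, TangentSpace I x →L[ℝ] ℝ
  smooth_φ : ContMDiff I (I.prod 𝓘(ℝ, E →L[ℝ] E)) ∞
    (fun x ↦ TotalSpace.mk' (E →L[ℝ] E)
      (E := fun x : M ↦ TangentSpace I x →L[ℝ] TangentSpace I x) x (φ x))
  smooth_ξ : CMDiff ∞ (T% ξ)
  smooth_η : ContMDiff I (I.prod 𝓘(ℝ, E →L[ℝ] ℝ)) ∞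
    (fun x ↦ TotalSpace.mk' (E →L[ℝ] ℝ)
      (E := fun x : M ↦ TangentSpace I x →L[ℝ] ℝ) x (η x))
  φ_sq : ∀ x X, φ x (φ x X) = -X + η x X • ξ x
  η_ξ : ∀ x, η x (ξ x) = 1
  inner_φ : ∀ x X Y, (inner ℝ (φ x X) (φ x Y) : ℝ) = inner ℝ X Y - η x X * η x Y

/-- `tr A` of an endomorphism of `T_x M`. -/
def tr {x : M} (A : TangentSpace I x →L[ℝ] TangentSpace I x) : ℝ :=
  LinearMap.trace ℝ (TangentSpace I x) A.toLinearMap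

namespace AlmostContactMetricStructure

variable (s : AlmostContactMetricStructure I M)

/-- The structure on the tangent space at `x`. -/
def linAt (x : M) : LinearStructure (TangentSpace I x) where
  φ := (s.φ x).toLinearMap
  ξ := s.ξ x
  η := (s.η x).toLinearMap
  φ_sq := s.φ_sq x
  η_ξ := s.η_ξ x
  inner_φ := s.inner_φ x

/-- The vector field `φX`. -/
def φField (X : Π x : M, TangentSpace I x) : Π x : M, TangentSpace I x := fun x ↦ s.φ x (X x)

theorem mdifferentiableAt_φField {x : M} {X : Π x : M, TangentSpace I x}
    (hX : MDiffAt (T% X) x) : MDiffAt (T% (s.φField X)) x :=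
  ((s.smooth_φ x).mdifferentiableAt (by simp)).clm_bundle_apply hX

theorem mdifferentiableAt_ξ (x : M) : MDiffAt (T% s.ξ) x :=
  (s.smooth_ξ x).mdifferentiableAt (by simp)

/-- The fundamental `2`-form as a function `Φ(Y, Z) = g(Y, φZ)` on `M`. -/
def PhiField (Y Z : Π x : M, TangentSpace I x) : M → ℝ := fun x ↦ inner ℝ (Y x) (s.φ x (Z x))

/-- `X ↦ (∇_X Φ)(Y, Z) = X(Φ(Y, Z)) - Φ(∇_X Y, Z) - Φ(Y, ∇_X Z)` at `x`, where `∇` is the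
Levi-Civita connection. -/
def nablaPhiAux (Y Z : Π x : M, TangentSpace I x) (x : M) : TangentSpace I x →L[ℝ] ℝ :=
  d% (s.PhiField Y Z) x - innerSL ℝ (s.φ x (Z x)) ∘L leviCivita Y x
    - innerSL ℝ (Y x) ∘L s.φ x ∘L leviCivita Z x

theorem nablaPhiAux_apply (Y Z : Π x : M, TangentSpace I x) (x : M) (u : TangentSpace I x) :
    s.nablaPhiAux Y Z x u = d% (s.PhiField Y Z) x u
      - inner ℝ (leviCivita Y x u) (s.φ x (Z x)) - inner ℝ (Y x) (s.φ x (leviCivita Z x u)) := by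
  rw [real_inner_comm]
  rfl

theorem nablaPhiAux_tensorial_left {x : M} {Z : Π x : M, TangentSpace I x}
    (hZ : MDiffAt (T% Z) x) : TensorialAt I E (fun Y ↦ s.nablaPhiAux Y Z x) x where
  smul {f Y} hf hY := by
    have hi := mdifferentiableAt_inner hY (s.mdifferentiableAt_φField hZ)
    have h1 : s.PhiField (f • Y) Z = fun y ↦ f y * inner ℝ (Y y) (s.φField Z y) := by
      funext y
      simp only [PhiField, φField, Pi.smul_apply', real_inner_smul_left]
    ext u
    rw [smul_apply, nablaPhiAux_apply, nablaPhiAux_apply, h1, mvfderiv_fun_mul hf hi,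
      leviCivita.isCovariantDerivativeOn.leibniz (s := Set.univ) hY hf]
    simp only [add_apply, smul_apply, ContinuousLinearMap.smulRight_apply, inner_add_left,
      real_inner_smul_left, Pi.smul_apply', smul_eq_mul, φField]
    unfold PhiField
    ring
  add {Y Y'} hY hY' := by
    have hi := mdifferentiableAt_inner hY (s.mdifferentiableAt_φField hZ)
    have hi' := mdifferentiableAt_inner hY' (s.mdifferentiableAt_φField hZ)
    have h1 : s.PhiField (Y + Y') Z =
        fun y ↦ inner ℝ (Y y) (s.φField Z y) + inner ℝ (Y' y) (s.φField Z y) := by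
      funext y
      simp only [PhiField, φField, Pi.add_apply, inner_add_left]
    ext u
    rw [add_apply, nablaPhiAux_apply, nablaPhiAux_apply, nablaPhiAux_apply, h1,
      mvfderiv_fun_add hi hi',
      leviCivita.isCovariantDerivativeOn.add (s := Set.univ) hY hY']
    simp only [add_apply, inner_add_left, Pi.add_apply, φField]
    unfold PhiField
    ring

theorem nablaPhiAux_tensorial_right {x : M} {Y : Π x : M, TangentSpace I x}
    (hY : MDiffAt (T% Y) x) : TensorialAt I E (fun Z ↦ s.nablaPhiAux Y Z x) x where
  smul {f Z} hf hZ := by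
    have hi := mdifferentiableAt_inner hY (s.mdifferentiableAt_φField hZ)
    have h1 : s.PhiField Y (f • Z) = fun y ↦ f y * inner ℝ (Y y) (s.φField Z y) := by
      funext y
      simp only [PhiField, φField, Pi.smul_apply', map_smul, real_inner_smul_right]
    ext u
    rw [smul_apply, nablaPhiAux_apply, nablaPhiAux_apply, h1, mvfderiv_fun_mul hf hi,
      leviCivita.isCovariantDerivativeOn.leibniz (s := Set.univ) hZ hf]
    simp only [add_apply, smul_apply, ContinuousLinearMap.smulRight_apply, inner_add_right,
      real_inner_smul_right, Pi.smul_apply', smul_eq_mul, φField, map_add, map_smul]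
    unfold PhiField
    ring
  add {Z Z'} hZ hZ' := by
    have hi := mdifferentiableAt_inner hY (s.mdifferentiableAt_φField hZ)
    have hi' := mdifferentiableAt_inner hY (s.mdifferentiableAt_φField hZ')
    have h1 : s.PhiField Y (Z + Z') =
        fun y ↦ inner ℝ (Y y) (s.φField Z y) + inner ℝ (Y y) (s.φField Z' y) := by
      funext y
      simp only [PhiField, φField, Pi.add_apply, map_add, inner_add_right]
    ext u
    rw [add_apply, nablaPhiAux_apply, nablaPhiAux_apply, nablaPhiAux_apply, h1,
      mvfderiv_fun_add hi hi',
      leviCivita.isCovariantDerivativeOn.add (s := Set.univ) hZ hZ']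
    simp only [add_apply, inner_add_right, Pi.add_apply, φField, map_add]
    unfold PhiField
    ring

/-- `(Y, Z, X) ↦ (∇_X Φ)(Y, Z)` on `T_x M`. -/
def nablaPhiForm (x : M) :
    TangentSpace I x →L[ℝ] TangentSpace I x →L[ℝ] TangentSpace I x →L[ℝ] ℝ :=
  TensorialAt.mkHom₂ (fun Y Z ↦ s.nablaPhiAux Y Z x) x
    (fun _ hZ ↦ s.nablaPhiAux_tensorial_left hZ) (fun _ hY ↦ s.nablaPhiAux_tensorial_right hY)

/-- The `(0,3)`-tensor `(∇Φ)_x`, `(X, Y, Z) ↦ (∇_X Φ)(Y, Z)`. -/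
def nablaPhi (x : M) : Tensor3 (TangentSpace I x) :=
  LinearMap.mk₂ ℝ (fun X Y ↦
      { toFun := fun Z ↦ s.nablaPhiForm x Y Z X
        map_add' := fun Z Z' ↦ DFunLike.congr_fun ((s.nablaPhiForm x Y).map_add Z Z') X
        map_smul' := fun c Z ↦ DFunLike.congr_fun ((s.nablaPhiForm x Y).map_smul c Z) X })
    (fun X X' Y ↦ LinearMap.ext fun Z ↦ (s.nablaPhiForm x Y Z).map_add X X')
    (fun c X Y ↦ LinearMap.ext fun Z ↦ (s.nablaPhiForm x Y Z).map_smul c X)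
    (fun X Y Y' ↦ LinearMap.ext fun Z ↦
      DFunLike.congr_fun (DFunLike.congr_fun ((s.nablaPhiForm x).map_add Y Y') Z) X)
    (fun c X Y ↦ LinearMap.ext fun Z ↦
      DFunLike.congr_fun (DFunLike.congr_fun ((s.nablaPhiForm x).map_smul c Y) Z) X)

/-- `M` is of class `U`, for subspaces `U x` of `𝒞(T_x M)`. -/
def IsOfClass (U : Π x : M, Submodule ℝ (Tensor3 (TangentSpace I x))) : Prop :=
  ∀ x, s.nablaPhi x ∈ U x

/-- `M` is `ℋ`-parallel: `(∇_X Φ)(Y, Z) = 0` for all horizontal `X, Y, Z`. -/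
def IsHParallel : Prop :=
  ∀ x, ∀ X Y Z : TangentSpace I x, s.η x X = 0 → s.η x Y = 0 → s.η x Z = 0 →
    s.nablaPhi x X Y Z = 0

/-- `S = φ ∘ ∇ξ`. -/
def S (x : M) : TangentSpace I x →L[ℝ] TangentSpace I x := s.φ x ∘L leviCivita s.ξ x

theorem lieφ_tensorial (x : M) : TensorialAt I E
    (fun X ↦ mlieBracket I s.ξ (s.φField X) x - s.φ x (mlieBracket I s.ξ X x)) x where
  smul {f X} hf hX := by
    have h1 : s.φField (f • X) = f • s.φField X := by
      funext y
      simp [φField]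
    rw [h1, mlieBracket_smul_right hf (s.mdifferentiableAt_φField hX),
      mlieBracket_smul_right hf hX, map_add, map_smul, map_smul, smul_sub]
    simp only [φField]
    abel
  add {X X'} hX hX' := by
    have h1 : s.φField (X + X') = s.φField X + s.φField X' := by
      funext y
      simp [φField]
    rw [h1, mlieBracket_add_right (s.mdifferentiableAt_φField hX)
      (s.mdifferentiableAt_φField hX'), mlieBracket_add_right hX hX', map_add]
    abel

/-- The Lie derivative `ℒ_ξ φ`, `X ↦ [ξ, φX] - φ[ξ, X]`. -/
def lieφ (x : M) : TangentSpace I x →L[ℝ] TangentSpace I x :=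
  TensorialAt.mkHom
    (fun X ↦ mlieBracket I s.ξ (s.φField X) x - s.φ x (mlieBracket I s.ξ X x)) x
    (s.lieφ_tensorial x)

/-- `h = ½ ℒ_ξ φ`. -/
def h (x : M) : TangentSpace I x →L[ℝ] TangentSpace I x := (1 / 2 : ℝ) • s.lieφ x

/-- `P = -2h + φSφ + S`. -/
def P (x : M) : TangentSpace I x →L[ℝ] TangentSpace I x :=
  (-2 : ℝ) • s.h x + s.φ x ∘L s.S x ∘L s.φ x + s.S x

/-! Exterior derivatives and normality, evaluated on vector fields. -/

/-- `dη(X, Y) = X(η(Y)) - Y(η(X)) - η([X, Y])`. -/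
def dEta (X Y : Π x : M, TangentSpace I x) (x : M) : ℝ :=
  d% (fun y : M ↦ s.η y (Y y)) x (X x) - d% (fun y : M ↦ s.η y (X y)) x (Y x)
    - s.η x (mlieBracket I X Y x)

/-- `dΦ(X, Y, Z)`: the cyclic sum of `X(Φ(Y, Z)) - Φ([X, Y], Z)`. -/
def dPhi (X Y Z : Π x : M, TangentSpace I x) (x : M) : ℝ :=
  d% (s.PhiField Y Z) x (X x) + d% (s.PhiField Z X) x (Y x) + d% (s.PhiField X Y) x (Z x)
    - s.PhiField (mlieBracket I X Y) Z x - s.PhiField (mlieBracket I Y Z) X x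
    - s.PhiField (mlieBracket I Z X) Y x

/-- `N_φ(X, Y) = [φX, φY] + φ²[X, Y] - φ[X, φY] - φ[φX, Y] + dη(X, Y) ξ`. -/
def nijenhuis (X Y : Π x : M, TangentSpace I x) (x : M) : TangentSpace I x :=
  mlieBracket I (s.φField X) (s.φField Y) x + s.φ x (s.φ x (mlieBracket I X Y x))
    - s.φ x (mlieBracket I X (s.φField Y) x) - s.φ x (mlieBracket I (s.φField X) Y x)
    + s.dEta X Y x • s.ξ x

/-- `N_φ = 0`. -/
def IsNormal : Prop :=
  ∀ x, ∀ X Y : Π x : M, TangentSpace I x, CMDiffAt ∞ (T% X) x → CMDiffAt ∞ (T% Y) x →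
    s.nijenhuis X Y x = 0

/-- `dη = 2fΦ`. -/
def DEtaEq (f : M → ℝ) : Prop :=
  ∀ x, ∀ X Y : Π x : M, TangentSpace I x, CMDiffAt ∞ (T% X) x → CMDiffAt ∞ (T% Y) x →
    s.dEta X Y x = 2 * f x * s.PhiField X Y x

/-- `dΦ = 2f η ∧ Φ`. -/
def DPhiEq (f : M → ℝ) : Prop :=
  ∀ x, ∀ X Y Z : Π x : M, TangentSpace I x,
    CMDiffAt ∞ (T% X) x → CMDiffAt ∞ (T% Y) x → CMDiffAt ∞ (T% Z) x →
    s.dPhi X Y Z x = 2 * f x * (s.η x (X x) * s.PhiField Y Z x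
      + s.η x (Y x) * s.PhiField Z X x + s.η x (Z x) * s.PhiField X Y x)

/-- Almost cokähler: `dη = 0` and `dΦ = 0`. -/
def IsAlmostCokahler : Prop := s.DEtaEq 0 ∧ s.DPhiEq 0

/-- Quasi-Sasakian: normal and `dΦ = 0`. -/
def IsQuasiSasakian : Prop := s.IsNormal ∧ s.DPhiEq 0

/-- `β`-Kenmotsu: normal, `dη = 0` and `dΦ = 2β η ∧ Φ` for a function `β`. -/
def IsBetaKenmotsu : Prop := s.IsNormal ∧ s.DEtaEq 0 ∧ ∃ β : M → ℝ, s.DPhiEq β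

/-- `α`-Sasakian: quasi-Sasakian and `dη = 2αΦ` for a function `α`. -/
def IsAlphaSasakian : Prop := s.IsQuasiSasakian ∧ ∃ α : M → ℝ, s.DEtaEq α

end AlmostContactMetricStructure

end Manifold

end

end ACM

/-! ### Linear algebra of almost contact structures, and the classes as spaces of endomorphisms -/

namespace ACM

noncomputable section

namespace LinearStructure

section Linear

variable {V : Type*} [NormedAddCommGroup V] [InnerProductSpace ℝ V] (a : LinearStructure V)

/-! Everything is pointwise linear algebra in two endomorphisms. A tensor `α` in `CV` determines `S`
by `α(X,ξ,Z) = ⟨SX,Z⟩` and `F` by `α(ξ,Y,X) = ⟨Y,FX⟩`. If `α` vanishes on horizontal vectors, the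
symmetries of `CV` leave `α = ofEnd S - η(X) α(ξ,φY,φZ)` (`Represents.isHZero_iff`). The last term
is the `C11` part, and when `Sξ = 0` it is carried exactly by `F`.

The map `ofEnd` is injective on endomorphisms with `η ∘ S = 0`, and all classes except `C11` are
images under it: `C5` of the line of `φ`, `C6` of the line of `I - η ⊗ ξ`, `C12` of the `η ⊗ v`. The
classes `C7` to `C10` come from the four sign pairs `(ε, δ)` in `⟨SX,Y⟩ = ε⟨X,SY⟩`, `Sφ = δφS`,
namely `(1,1)`, `(-1,1)`, `(1,-1)`, `(-1,-1)`, with a trace condition added in the first two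
(`exists_ofEnd_iff`). Sums of classes thus become the decompositions of an endomorphism into
symmetric and skew, commuting and anticommuting, and trace and traceless parts. Orthogonality
becomes a statement about `tr(S'* S)`, because `ofEnd` doubles the trace inner product.

On the manifold, `α = ∇Φ` has `S = φ∇ξ` and `F = ∇_ξ φ`. Torsion-freeness gives `2h = F + φSφ + S`,
hence `P = -F` (`represents`). Each condition on `S`, `h`, `P` can then be read off from `S` and
`F`. Since `dη`, `dΦ` and the normality tensor are also polynomial in `α`, `S` and the structure,
the named classes follow by inserting `ξ` into their equations (`normal_iff`, `almostCokahler_iff`,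
and the lemmas after them). -/

theorem ξ_ne_zero : a.ξ ≠ 0 := fun h ↦ by
  have := a.η_ξ
  rw [h, map_zero] at this
  exact zero_ne_one this

-- From `φ²ξ = 0`, the identity for `φ²` at `φξ` gives `φξ = cξ` with `c = η(φξ)`. Then `c²ξ = φ²ξ =
-- 0`, so `c = 0`.
@[simp] theorem φ_ξ : a.φ a.ξ = 0 := by
  have h0 : a.φ (a.φ a.ξ) = 0 := by rw [a.φ_sq, a.η_ξ, one_smul, neg_add_cancel]
  have h1 := a.φ_sq (a.φ a.ξ)
  rw [h0, map_zero] at h1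
  have h2 : a.φ a.ξ = a.η (a.φ a.ξ) • a.ξ := by
    rwa [eq_comm, neg_add_eq_zero] at h1
  have h3 : a.η (a.φ a.ξ) • a.η (a.φ a.ξ) • a.ξ = 0 := by
    rw [← h2, ← map_smul, ← h2, h0]
  rw [smul_smul, smul_eq_zero, or_iff_left a.ξ_ne_zero, mul_self_eq_zero] at h3
  rw [h2, h3, zero_smul]

-- Comparing `φ²(φX)` with `φ(φ²X)` leaves `η(φX) ξ = 0`.
@[simp] theorem η_φ (X : V) : a.η (a.φ X) = 0 := by
  have h1 := a.φ_sq (a.φ X)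
  rw [a.φ_sq X] at h1
  simpa [a.ξ_ne_zero] using h1

theorem inner_ξ (X : V) : inner ℝ X a.ξ = a.η X := by
  have := a.inner_φ X a.ξ
  rw [φ_ξ, inner_zero_right, a.η_ξ, mul_one] at this
  linarith

theorem inner_ξ_left (X : V) : inner ℝ a.ξ X = a.η X := by
  rw [real_inner_comm, inner_ξ]

theorem inner_φ_left (X Y : V) : inner ℝ (a.φ X) Y = -inner ℝ X (a.φ Y) := by
  have := a.inner_φ X (a.φ Y)
  rw [a.φ_sq, inner_add_right, inner_neg_right, real_inner_smul_right, inner_ξ, η_φ, η_φ] at this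
  linarith

/-- The tensor `(X, Y, Z) ↦ η(Y) ⟨S X, Z⟩ - η(Z) ⟨S X, Y⟩`. -/
def ofEnd : (V →ₗ[ℝ] V) →ₗ[ℝ] Tensor3 V where
  toFun S := LinearMap.mk₂ ℝ
    (fun X Y ↦ a.η Y • (innerₗ V (S X)) - (innerₗ V (S X) Y) • a.η)
    (fun X X' Y ↦ by ext Z; simp [inner_add_left]; ring)
    (fun c X Y ↦ by ext Z; simp [real_inner_smul_left]; ring)
    (fun X Y Y' ↦ by ext Z; simp [inner_add_right]; ring)
    (fun c X Y ↦ by ext Z; simp [real_inner_smul_right]; ring)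
  map_add' S S' := by ext X Y Z; simp [inner_add_left]; ring
  map_smul' c S := by ext X Y Z; simp [real_inner_smul_left]; ring

theorem ofEnd_apply (S : V →ₗ[ℝ] V) (X Y Z : V) :
    a.ofEnd S X Y Z = a.η Y * inner ℝ (S X) Z - a.η Z * inner ℝ (S X) Y := by
  simp [ofEnd]; ring

/-- Endomorphisms `S` with `η ∘ S = 0`. -/
def EndTo : Submodule ℝ (V →ₗ[ℝ] V) where
  carrier := {S | ∀ X, a.η (S X) = 0}
  zero_mem' := fun X ↦ by simp
  add_mem' := fun h k X ↦ by simp [h X, k X]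
  smul_mem' := fun c S h X ↦ by simp [h X]

/-- Endomorphisms of `ℋ`, extended by zero. -/
def EndH : Submodule ℝ (V →ₗ[ℝ] V) where
  carrier := {S | S a.ξ = 0 ∧ ∀ X, a.η (S X) = 0}
  zero_mem' := by simp
  add_mem' := fun h k ↦ by simp [h.1, h.2, k.1, k.2]
  smul_mem' := fun c S h ↦ by simp [h.1, h.2]

/-- Endomorphisms `S` of `ℋ` with `⟨S X, Y⟩ = ε ⟨X, S Y⟩`. -/
def EndSym (ε : ℝ) : Submodule ℝ (V →ₗ[ℝ] V) where
  carrier := {S | S ∈ a.EndH ∧ ∀ X Y, inner ℝ (S X) Y = ε * inner ℝ X (S Y)}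
  zero_mem' := ⟨zero_mem _, by simp⟩
  add_mem' := fun h k ↦ ⟨add_mem h.1 k.1, fun X Y ↦ by
    simp [inner_add_left, inner_add_right, h.2, k.2]; ring⟩
  smul_mem' := fun c S h ↦ ⟨Submodule.smul_mem _ c h.1, fun X Y ↦ by
    simp [real_inner_smul_left, real_inner_smul_right, h.2]; ring⟩

/-- Endomorphisms `S` of `ℋ` with `S φ = ε φ S`. -/
def EndComm (ε : ℝ) : Submodule ℝ (V →ₗ[ℝ] V) where
  carrier := {S | S ∈ a.EndH ∧ ∀ X, S (a.φ X) = ε • a.φ (S X)}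
  zero_mem' := ⟨zero_mem _, by simp⟩
  add_mem' := fun h k ↦ ⟨add_mem h.1 k.1, fun X ↦ by simp [h.2, k.2]⟩
  smul_mem' := fun c S h ↦ ⟨Submodule.smul_mem _ c h.1, fun X ↦ by
    simp [h.2, smul_comm c ε]⟩

/-- The endomorphisms `η ⊗ v` with `v` horizontal. -/
def EndRank : Submodule ℝ (V →ₗ[ℝ] V) where
  carrier := {S | (∀ X, a.η (S X) = 0) ∧ ∀ X, S X = a.η X • S a.ξ}
  zero_mem' := by simp
  add_mem' := fun {S S'} h k ↦ ⟨fun X ↦ by simp [h.1, k.1], fun X ↦ by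
    rw [LinearMap.add_apply, LinearMap.add_apply, h.2 X, k.2 X, smul_add]⟩
  smul_mem' := fun c S h ↦ ⟨fun X ↦ by simp [h.1], fun X ↦ by
    rw [LinearMap.smul_apply, LinearMap.smul_apply, h.2 X, smul_comm]⟩

/-- The projection `I - η ⊗ ξ` onto `ℋ`. -/
def proj : V →ₗ[ℝ] V := LinearMap.id - a.η.smulRight a.ξ

@[simp] theorem proj_apply (X : V) : a.proj X = X - a.η X • a.ξ := by simp [proj]

theorem mem_EndTo {S : V →ₗ[ℝ] V} : S ∈ a.EndTo ↔ ∀ X, a.η (S X) = 0 := Iff.rfl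

theorem mem_EndH {S : V →ₗ[ℝ] V} : S ∈ a.EndH ↔ S a.ξ = 0 ∧ ∀ X, a.η (S X) = 0 := Iff.rfl

theorem mem_EndComm {ε : ℝ} {S : V →ₗ[ℝ] V} :
    S ∈ a.EndComm ε ↔ S ∈ a.EndH ∧ ∀ X, S (a.φ X) = ε • a.φ (S X) := Iff.rfl

theorem EndH_le_EndTo : a.EndH ≤ a.EndTo := fun _ h ↦ h.2

theorem EndSym_le_EndH (ε : ℝ) : a.EndSym ε ≤ a.EndH := fun _ h ↦ h.1

theorem EndComm_le_EndH (ε : ℝ) : a.EndComm ε ≤ a.EndH := fun _ h ↦ h.1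

theorem φ_mem_EndH : a.φ ∈ a.EndH := ⟨a.φ_ξ, a.η_φ⟩

theorem proj_mem_EndH : a.proj ∈ a.EndH := by
  constructor <;> simp [a.η_ξ]

theorem φ_mem_EndSym : a.φ ∈ a.EndSym (-1) :=
  ⟨a.φ_mem_EndH, fun X Y ↦ by rw [inner_φ_left]; ring⟩

theorem proj_mem_EndSym : a.proj ∈ a.EndSym 1 :=
  ⟨a.proj_mem_EndH, fun X Y ↦ by
    simp [inner_sub_left, inner_sub_right, real_inner_smul_left, real_inner_smul_right, inner_ξ,
      inner_ξ_left]
    ring⟩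

theorem φ_mem_EndComm : a.φ ∈ a.EndComm 1 := ⟨a.φ_mem_EndH, fun X ↦ by simp⟩

theorem proj_mem_EndComm : a.proj ∈ a.EndComm 1 := ⟨a.proj_mem_EndH, fun X ↦ by simp⟩

/-- Composing with `φ` on the left is reversible here, since `φ² = -1` on the range of `S`. The form
`φSφ = -εS` is the one that meets the term `φSφ` in the formula for `h`. -/
theorem mem_EndComm_iff {ε : ℝ} {S : V →ₗ[ℝ] V} (hS : S ∈ a.EndH) :
    S ∈ a.EndComm ε ↔ ∀ X, a.φ (S (a.φ X)) = -(ε • S X) := by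
  constructor
  · intro h X
    rw [h.2, map_smul, a.φ_sq, hS.2, zero_smul, add_zero, smul_neg]
  · intro h
    refine ⟨hS, fun X ↦ ?_⟩
    have h1 := congrArg a.φ (h X)
    rw [a.φ_sq, hS.2, zero_smul, add_zero, map_neg, neg_inj, map_smul] at h1
    exact h1

/-- Inserting `ξ` in the second slot recovers `S`, which makes `ofEnd` injective on `EndTo`. -/
theorem ofEnd_ξ {S : V →ₗ[ℝ] V} (hS : S ∈ a.EndTo) (X Z : V) :
    a.ofEnd S X a.ξ Z = inner ℝ (S X) Z := by
  rw [ofEnd_apply, a.η_ξ, inner_ξ, hS]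
  ring

variable [FiniteDimensional ℝ V]

theorem ofEnd_mem_CV {S : V →ₗ[ℝ] V} (hS : S ∈ a.EndTo) : a.ofEnd S ∈ a.CV := fun X Y Z ↦ by
  simp only [ofEnd_apply, a.η_ξ, inner_ξ, hS X, η_φ]
  constructor <;> ring

theorem CV_skew {α : Tensor3 V} (hα : α ∈ a.CV) (X Y Z : V) : α X Y Z = -α X Z Y := (hα X Y Z).1

theorem CV_ξ_ξ {α : Tensor3 V} (hα : α ∈ a.CV) (X : V) : α X a.ξ a.ξ = 0 := by
  linarith [(hα X a.ξ a.ξ).1]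

/-- The endomorphism `S` with `α(X, ξ, Z) = ⟨S X, Z⟩`. -/
theorem exists_end {α : Tensor3 V} (hα : α ∈ a.CV) :
    ∃ S ∈ a.EndTo, ∀ X Z, α X a.ξ Z = inner ℝ (S X) Z := by
  let R (f : V →ₗ[ℝ] ℝ) : V :=
    (InnerProductSpace.toDual ℝ V).symm (LinearMap.toContinuousLinearMap f)
  have hR (f : V →ₗ[ℝ] ℝ) (Z : V) : inner ℝ (R f) Z = f Z := by simp [R]
  refine ⟨{ toFun := fun X ↦ R (α X a.ξ), map_add' := fun X Y ↦ ?_, map_smul' := fun c X ↦ ?_ },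
    fun X ↦ ?_, fun X Z ↦ ?_⟩
  · exact ext_inner_right ℝ fun Z ↦ by simp [inner_add_left, hR]
  · exact ext_inner_right ℝ fun Z ↦ by simp [real_inner_smul_left, hR]
  · rw [← inner_ξ]
    exact (hR _ _).trans (a.CV_ξ_ξ hα X)
  · exact (hR _ _).symm

theorem nablaEta_eq {α : Tensor3 V} {S : V →ₗ[ℝ] V}
    (h : ∀ X Z, α X a.ξ Z = inner ℝ (S X) Z) (X Y : V) :
    a.nablaEta α X Y = inner ℝ (S X) (a.φ Y) := h X _

theorem deltaEta_eq {α : Tensor3 V} {S : V →ₗ[ℝ] V}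
    (h : ∀ X Z, α X a.ξ Z = inner ℝ (S X) Z) :
    a.deltaEta α = LinearMap.trace ℝ V (a.φ ∘ₗ S) := by
  rw [LinearMap.trace_eq_sum_inner _ (stdOrthonormalBasis ℝ V), deltaEta, ← Finset.sum_neg_distrib]
  refine Finset.sum_congr rfl fun i _ ↦ ?_
  rw [nablaEta_eq a h, LinearMap.comp_apply, real_inner_comm, inner_φ_left, neg_neg,
    real_inner_comm]

theorem deltaPhi_ξ_eq {α : Tensor3 V} (hα : α ∈ a.CV) {S : V →ₗ[ℝ] V}
    (h : ∀ X Z, α X a.ξ Z = inner ℝ (S X) Z) :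
    a.deltaPhi α a.ξ = LinearMap.trace ℝ V S := by
  rw [LinearMap.trace_eq_sum_inner _ (stdOrthonormalBasis ℝ V), deltaPhi, ← Finset.sum_neg_distrib]
  refine Finset.sum_congr rfl fun i _ ↦ ?_
  rw [a.CV_skew hα, neg_neg, h, real_inner_comm]

/-- The other half of the contraction is `⟨S(∑ η(eᵢ)eᵢ), Z⟩ = ⟨Sξ,Z⟩ = 0`. Hence the requirement `δΦ
= 0` for all `Z` in `C7` is the single equation `tr S = 0`. -/
theorem deltaPhi_ofEnd {S : V →ₗ[ℝ] V} (hS : S ∈ a.EndH) (Z : V) :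
    a.deltaPhi (a.ofEnd S) Z = a.η Z * LinearMap.trace ℝ V S := by
  rw [LinearMap.trace_eq_sum_inner _ (stdOrthonormalBasis ℝ V), deltaPhi, Finset.mul_sum]
  have h1 : ∑ i, a.η (stdOrthonormalBasis ℝ V i) * inner ℝ (S (stdOrthonormalBasis ℝ V i)) Z
      = 0 := by
    have h2 : S (∑ i, a.η (stdOrthonormalBasis ℝ V i) • stdOrthonormalBasis ℝ V i) = 0 := by
      simp_rw [← inner_ξ]
      rw [OrthonormalBasis.sum_repr', hS.1]
    rw [map_sum] at h2
    simp_rw [← real_inner_smul_left, ← sum_inner, ← map_smul, h2, inner_zero_left]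
  simp only [ofEnd_apply, Finset.sum_sub_distrib, h1]
  rw [zero_sub, neg_neg]
  exact Finset.sum_congr rfl fun i _ ↦ by rw [real_inner_comm]

/-! ### The classes as images of spaces of endomorphisms -/

theorem trace_φ_φ {n : ℕ} (hn : Module.finrank ℝ V = 2 * n + 1) :
    LinearMap.trace ℝ V (a.φ ∘ₗ a.φ) = -(2 * n) := by
  have h : a.φ ∘ₗ a.φ = -LinearMap.id + a.η.smulRight a.ξ := by
    ext X; simp [a.φ_sq]
  rw [h, map_add, map_neg, LinearMap.trace_id, LinearMap.trace_smulRight, a.η_ξ, hn]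
  push_cast
  ring

theorem trace_proj {n : ℕ} (hn : Module.finrank ℝ V = 2 * n + 1) :
    LinearMap.trace ℝ V a.proj = 2 * n := by
  rw [proj, map_sub, LinearMap.trace_id, LinearMap.trace_smulRight, a.η_ξ, hn]
  push_cast
  ring

/-- In dimension one `ξ` spans the space. This settles the case `n = 0`, where `1 / (2 * n)`
evaluates to `0` and no trace can be normalised. -/
theorem eq_zero_of_finrank_one {n : ℕ} (hn : Module.finrank ℝ V = 2 * n + 1) (h0 : n = 0)
    {S : V →ₗ[ℝ] V} (hS : S ∈ a.EndH) : S = 0 := by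
  subst h0
  ext X
  obtain ⟨c, rfl⟩ := (finrank_eq_one_iff_of_nonzero' a.ξ a.ξ_ne_zero).1 (by simpa using hn) X
  simp [hS.1]

/-- Since `⟨φX,Z⟩ = -Φ(X,Z)`, the defining equation says that `α` is a multiple of `ofEnd φ`. The
prescribed coefficient is automatic in the converse, because `δη` of `ofEnd (cφ)` is `tr(cφ²) =
-2nc`. -/
theorem C5_eq {n : ℕ} (hn : Module.finrank ℝ V = 2 * n + 1) :
    a.C5 n = (Submodule.span ℝ {a.φ}).map a.ofEnd := by
  ext α
  simp only [Submodule.mem_map, Submodule.mem_span_singleton]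
  constructor
  · rintro ⟨hα, h⟩
    refine ⟨_, ⟨-(1 / (2 * n) * a.deltaEta α), rfl⟩, ?_⟩
    ext X Y Z
    rw [h, ofEnd_apply]
    simp [real_inner_smul_left, inner_φ_left, Phi]
    ring
  · rintro ⟨_, ⟨c, rfl⟩, rfl⟩
    have hc : c • a.φ ∈ a.EndTo := Submodule.smul_mem _ _ a.φ_mem_EndH.2
    rcases eq_or_ne n 0 with h0 | h0
    · rw [a.eq_zero_of_finrank_one hn h0 a.φ_mem_EndH, smul_zero, map_zero]
      exact zero_mem _
    refine ⟨a.ofEnd_mem_CV hc, fun X Y Z ↦ ?_⟩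
    rw [a.deltaEta_eq (a.ofEnd_ξ hc), LinearMap.comp_smul, map_smul (LinearMap.trace ℝ V),
      a.trace_φ_φ hn, ofEnd_apply]
    have : (n : ℝ) ≠ 0 := by exact_mod_cast h0
    simp [real_inner_smul_left, inner_φ_left, Phi]
    field_simp
    ring

theorem C6_eq {n : ℕ} (hn : Module.finrank ℝ V = 2 * n + 1) :
    a.C6 n = (Submodule.span ℝ {a.proj}).map a.ofEnd := by
  ext α
  simp only [Submodule.mem_map, Submodule.mem_span_singleton]
  constructor
  · rintro ⟨hα, h⟩
    refine ⟨_, ⟨1 / (2 * n) * a.deltaPhi α a.ξ, rfl⟩, ?_⟩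
    ext X Y Z
    rw [h, ofEnd_apply]
    simp [real_inner_smul_left, inner_sub_left, inner_ξ_left]
    ring
  · rintro ⟨_, ⟨c, rfl⟩, rfl⟩
    have hc : c • a.proj ∈ a.EndH := Submodule.smul_mem _ _ a.proj_mem_EndH
    rcases eq_or_ne n 0 with h0 | h0
    · rw [a.eq_zero_of_finrank_one hn h0 a.proj_mem_EndH, smul_zero, map_zero]
      exact zero_mem _
    refine ⟨a.ofEnd_mem_CV hc.2, fun X Y Z ↦ ?_⟩
    rw [a.deltaPhi_ofEnd hc, map_smul (LinearMap.trace ℝ V), a.trace_proj hn, ofEnd_apply, a.η_ξ]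
    have : (n : ℝ) ≠ 0 := by exact_mod_cast h0
    simp [real_inner_smul_left, inner_sub_left, inner_ξ_left]
    field_simp
    ring

/-- The common form of the equations defining `𝒞_7, …, 𝒞_10`. -/
theorem exists_ofEnd_iff {ε δ : ℝ} (hδ : δ * δ = 1) {α : Tensor3 V} :
    (α ∈ a.CV ∧ ∀ X Y Z, α X Y Z = ε * (a.η Z * a.nablaEta α Y (a.φ X))
      + δ * (a.η Y * a.nablaEta α (a.φ X) Z)) ↔
      ∃ S ∈ a.EndSym ε ⊓ a.EndComm δ, a.ofEnd S = α := by
  constructor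
  · rintro ⟨hα, h⟩
    obtain ⟨S, hS, hSα⟩ := a.exists_end hα
    have hη (X) : a.nablaEta α X a.ξ = 0 := by rw [nablaEta, φ_ξ, map_zero]
    -- The case `X = Y = ξ` of the equation: both terms contain `φξ = 0`.
    have hξ : S a.ξ = 0 := ext_inner_right ℝ fun Z ↦ by
      rw [← hSα, h, φ_ξ, inner_zero_left]
      simp [nablaEta]
    have hH : S ∈ a.EndH := ⟨hξ, hS⟩
    -- The case `Y = ξ`: the `ε` term drops out because `Sξ = 0`.
    have hcomm (X Z) : inner ℝ (S X) Z = δ * inner ℝ (S (a.φ X)) (a.φ Z) := by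
      rw [← hSα, h, nablaEta_eq a hSα, nablaEta_eq a hSα, hξ, a.η_ξ]
      simp
    -- The case `Z = ξ`: now the `δ` term drops out, and `φ²X` produces the sign.
    have hsym (X Y) : inner ℝ (S X) Y = ε * inner ℝ X (S Y) := by
      have h1 : α X Y a.ξ = -inner ℝ (S X) Y := by rw [a.CV_skew hα, hSα]
      rw [h, hη, nablaEta_eq a hSα, a.φ_sq, a.η_ξ, inner_add_right, real_inner_smul_right,
        inner_ξ, hS, inner_neg_right, real_inner_comm] at h1
      linarith
    refine ⟨S, ⟨⟨hH, hsym⟩, (a.mem_EndComm_iff hH).2 fun X ↦ ?_⟩, ?_⟩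
    · refine ext_inner_right ℝ fun Z ↦ ?_
      rw [inner_φ_left, inner_neg_left, real_inner_smul_left, hcomm X Z, ← mul_assoc, hδ, one_mul]
    · ext X Y Z
      rw [h, ofEnd_apply, nablaEta_eq a hSα, nablaEta_eq a hSα, hcomm X Z, hsym X Y, a.φ_sq,
        inner_add_right, real_inner_smul_right, inner_ξ, hS, inner_neg_right, real_inner_comm X]
      ring
  · rintro ⟨S, ⟨hsym, hcomm⟩, rfl⟩
    have hS := hsym.1
    have hSα := a.ofEnd_ξ hS.2
    have hc (X) := (a.mem_EndComm_iff hS).1 hcomm X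
    refine ⟨a.ofEnd_mem_CV hS.2, fun X Y Z ↦ ?_⟩
    have h1 : inner ℝ (S (a.φ X)) (a.φ Z) = δ * inner ℝ (S X) Z := by
      rw [← neg_inj, ← inner_φ_left, hc, inner_neg_left, real_inner_smul_left]
    rw [ofEnd_apply, nablaEta_eq a hSα, nablaEta_eq a hSα, h1, a.φ_sq,
        inner_add_right, real_inner_smul_right, inner_ξ, hS.2, inner_neg_right,
        hsym.2 X Y, real_inner_comm X, ← mul_assoc, mul_left_comm δ, ← mul_assoc δ δ, hδ]
    ring

/-- Endomorphisms with vanishing trace. -/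
def EndTr : Submodule ℝ (V →ₗ[ℝ] V) := LinearMap.ker (LinearMap.trace ℝ V)

/-- Endomorphisms `S` with `tr (φ S) = 0`. -/
def EndTrφ : Submodule ℝ (V →ₗ[ℝ] V) :=
  LinearMap.ker (LinearMap.trace ℝ V ∘ₗ LinearMap.compRight ℝ a.φ)

theorem mem_EndTrφ {S : V →ₗ[ℝ] V} :
    S ∈ a.EndTrφ ↔ LinearMap.trace ℝ V (a.φ ∘ₗ S) = 0 := Iff.rfl

theorem C9_eq : a.C9 = (a.EndSym 1 ⊓ a.EndComm (-1)).map a.ofEnd := by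
  ext α
  rw [Submodule.mem_map, ← a.exists_ofEnd_iff (by norm_num)]
  refine and_congr Iff.rfl ?_
  simp only [one_mul, neg_mul, sub_eq_add_neg]

theorem C10_eq : a.C10 = (a.EndSym (-1) ⊓ a.EndComm (-1)).map a.ofEnd := by
  ext α
  rw [Submodule.mem_map, ← a.exists_ofEnd_iff (by norm_num)]
  refine and_congr Iff.rfl ?_
  simp only [one_mul, neg_mul, sub_eq_add_neg]

theorem C7_eq : a.C7 = (a.EndSym 1 ⊓ a.EndComm 1 ⊓ EndTr).map a.ofEnd := by
  ext α
  have h := a.exists_ofEnd_iff (ε := 1) (δ := 1) (by norm_num) (α := α)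
  simp only [one_mul] at h
  change (_ ∧ _ ∧ _) ↔ _
  rw [← and_assoc, h, Submodule.mem_map]
  constructor
  · rintro ⟨⟨S, hS, rfl⟩, ht⟩
    refine ⟨S, ⟨hS, ?_⟩, rfl⟩
    have := ht a.ξ
    rwa [a.deltaPhi_ofEnd hS.1.1, a.η_ξ, one_mul] at this
  · rintro ⟨S, ⟨hS, ht⟩, rfl⟩
    refine ⟨⟨S, hS, rfl⟩, fun Z ↦ ?_⟩
    rw [a.deltaPhi_ofEnd hS.1.1, LinearMap.mem_ker.1 ht, mul_zero]

theorem C8_eq : a.C8 = (a.EndSym (-1) ⊓ a.EndComm 1 ⊓ a.EndTrφ).map a.ofEnd := by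
  ext α
  have h := a.exists_ofEnd_iff (ε := -1) (δ := 1) (by norm_num) (α := α)
  simp only [one_mul, neg_mul] at h
  change (_ ∧ _ ∧ _) ↔ _
  rw [← and_assoc, h, Submodule.mem_map]
  constructor
  · rintro ⟨⟨S, hS, rfl⟩, ht⟩
    refine ⟨S, ⟨hS, ?_⟩, rfl⟩
    rwa [a.deltaEta_eq (a.ofEnd_ξ hS.1.1.2)] at ht
  · rintro ⟨S, ⟨hS, ht⟩, rfl⟩
    refine ⟨⟨S, hS, rfl⟩, ?_⟩
    rwa [a.deltaEta_eq (a.ofEnd_ξ hS.1.1.2)]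

/-- As `(∇_ξ η)(φY)` becomes `⟨Sξ,φ²Y⟩ = -⟨Sξ,Y⟩`, the equation is that of `ofEnd (η ⊗ Sξ)`; its
case `Y = ξ` forces `S = η ⊗ Sξ`. -/
theorem C12_eq : a.C12 = a.EndRank.map a.ofEnd := by
  ext α
  rw [Submodule.mem_map]
  have key {S : V →ₗ[ℝ] V} (hS : S ∈ a.EndTo) (hSα : ∀ X Z, α X a.ξ Z = inner ℝ (S X) Z) (Y : V) :
      a.nablaEta α a.ξ (a.φ Y) = -inner ℝ (S a.ξ) Y := by
    rw [nablaEta_eq a hSα, a.φ_sq, inner_add_right, real_inner_smul_right, inner_ξ, hS,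
      inner_neg_right, mul_zero, add_zero]
  constructor
  · rintro ⟨hα, h⟩
    obtain ⟨S, hS, hSα⟩ := a.exists_end hα
    have h1 (X) : S X = a.η X • S a.ξ := ext_inner_right ℝ fun Z ↦ by
      rw [← hSα, h, key hS hSα, key hS hSα, inner_ξ, hS, a.η_ξ, real_inner_smul_left]
      ring
    refine ⟨S, ⟨hS, h1⟩, ?_⟩
    ext X Y Z
    rw [h, key hS hSα, key hS hSα, ofEnd_apply, h1 X, real_inner_smul_left, real_inner_smul_left]
    ring
  · rintro ⟨S, hS, rfl⟩
    refine ⟨a.ofEnd_mem_CV hS.1, fun X Y Z ↦ ?_⟩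
    rw [key hS.1 (a.ofEnd_ξ hS.1), key hS.1 (a.ofEnd_ξ hS.1), ofEnd_apply, hS.2 X,
      real_inner_smul_left, real_inner_smul_left]
    ring

end Linear

end LinearStructure

end

end ACM

/-! ### Sums of classes and their orthogonality -/

namespace ACM

noncomputable section

namespace LinearStructure

section Sums

variable {V : Type*} [NormedAddCommGroup V] [InnerProductSpace ℝ V] [FiniteDimensional ℝ V]
  (a : LinearStructure V)

theorem span_φ_sup {n : ℕ} (hn : Module.finrank ℝ V = 2 * n + 1) :
    Submodule.span ℝ {a.φ} ⊔ a.EndSym (-1) ⊓ a.EndComm 1 ⊓ a.EndTrφ =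
      a.EndSym (-1) ⊓ a.EndComm 1 := by
  have hφ : a.φ ∈ a.EndSym (-1) ⊓ a.EndComm 1 := ⟨a.φ_mem_EndSym, a.φ_mem_EndComm⟩
  refine le_antisymm (sup_le (by simpa using hφ) inf_le_left) fun S hS ↦ ?_
  rcases eq_or_ne n 0 with h0 | h0
  · rw [a.eq_zero_of_finrank_one hn h0 hS.1.1]
    exact zero_mem _
  have hn0 : (n : ℝ) ≠ 0 := by exact_mod_cast h0
  -- Chosen so that `tr(φ(S - cφ)) = tr(φS) + 2nc` vanishes.
  set c : ℝ := -(1 / (2 * n)) * LinearMap.trace ℝ V (a.φ ∘ₗ S)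
  refine Submodule.mem_sup.2 ⟨c • a.φ, Submodule.mem_span_singleton.2 ⟨c, rfl⟩, S - c • a.φ,
    ⟨sub_mem hS (Submodule.smul_mem _ c hφ), ?_⟩, add_sub_cancel _ _⟩
  rw [SetLike.mem_coe, mem_EndTrφ, LinearMap.comp_sub, LinearMap.comp_smul, map_sub, map_smul,
    a.trace_φ_φ hn]
  simp only [c, smul_eq_mul]
  field_simp
  ring

theorem span_proj_sup {n : ℕ} (hn : Module.finrank ℝ V = 2 * n + 1) :
    Submodule.span ℝ {a.proj} ⊔ a.EndSym 1 ⊓ a.EndComm 1 ⊓ EndTr =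
      a.EndSym 1 ⊓ a.EndComm 1 := by
  have hφ : a.proj ∈ a.EndSym 1 ⊓ a.EndComm 1 := ⟨a.proj_mem_EndSym, a.proj_mem_EndComm⟩
  refine le_antisymm (sup_le (by simpa using hφ) inf_le_left) fun S hS ↦ ?_
  rcases eq_or_ne n 0 with h0 | h0
  · rw [a.eq_zero_of_finrank_one hn h0 hS.1.1]
    exact zero_mem _
  have hn0 : (n : ℝ) ≠ 0 := by exact_mod_cast h0
  set c : ℝ := 1 / (2 * n) * LinearMap.trace ℝ V S
  refine Submodule.mem_sup.2 ⟨c • a.proj, Submodule.mem_span_singleton.2 ⟨c, rfl⟩,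
    S - c • a.proj, ⟨sub_mem hS (Submodule.smul_mem _ c hφ), ?_⟩, add_sub_cancel _ _⟩
  rw [EndTr, SetLike.mem_coe, LinearMap.mem_ker, map_sub, map_smul, a.trace_proj hn]
  simp only [c, smul_eq_mul]
  field_simp
  ring

theorem adjoint_mem_EndH {S : V →ₗ[ℝ] V} (hS : S ∈ a.EndH) : S.adjoint ∈ a.EndH := by
  constructor
  · refine ext_inner_right ℝ fun Z ↦ ?_
    rw [LinearMap.adjoint_inner_left, inner_ξ_left, hS.2, inner_zero_left]
  · intro X
    rw [← inner_ξ, LinearMap.adjoint_inner_left, hS.1, inner_zero_right]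

/-- Since `φ* = -φ`, the adjoint of `Sφ = δφS` is `φS* = δS*φ`, and `δ² = 1` moves `δ` to the other
side. -/
theorem adjoint_mem_EndComm {δ : ℝ} (hδ : δ * δ = 1) {S : V →ₗ[ℝ] V} (hS : S ∈ a.EndComm δ) :
    S.adjoint ∈ a.EndComm δ := by
  refine ⟨a.adjoint_mem_EndH hS.1, fun X ↦ ext_inner_right ℝ fun Z ↦ ?_⟩
  rw [LinearMap.adjoint_inner_left, inner_φ_left, real_inner_smul_left, inner_φ_left,
    LinearMap.adjoint_inner_left, hS.2, real_inner_smul_right, mul_neg, ← mul_assoc, hδ, one_mul]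

/-- The halves `½(S ± S*)` keep the commutation rule, because the adjoint does. -/
theorem EndSym_sup {δ : ℝ} (hδ : δ * δ = 1) :
    a.EndSym 1 ⊓ a.EndComm δ ⊔ a.EndSym (-1) ⊓ a.EndComm δ = a.EndComm δ := by
  refine le_antisymm (sup_le inf_le_right inf_le_right) fun S hS ↦ ?_
  have hT := a.adjoint_mem_EndComm hδ hS
  have h1 := Submodule.smul_mem _ (1 / 2 : ℝ) (add_mem hS hT)
  have h2 := Submodule.smul_mem _ (1 / 2 : ℝ) (sub_mem hS hT)
  refine Submodule.mem_sup.2 ⟨_, ⟨⟨h1.1, fun X Y ↦ ?_⟩, h1⟩, _, ⟨⟨h2.1, fun X Y ↦ ?_⟩, h2⟩, ?_⟩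
  · simp [inner_add_left, inner_add_right, real_inner_smul_left, real_inner_smul_right,
      LinearMap.adjoint_inner_left, LinearMap.adjoint_inner_right]
    ring
  · simp [inner_sub_left, inner_sub_right, real_inner_smul_left, real_inner_smul_right,
      LinearMap.adjoint_inner_left, LinearMap.adjoint_inner_right]
    ring
  · module

/-- On `EndH` the map `S ↦ -φSφ` is an involution whose eigenspaces are the commuting and the
anticommuting endomorphisms; the witnesses are `½(S ∓ φSφ)`. -/
theorem EndComm_sup : a.EndComm 1 ⊔ a.EndComm (-1) = a.EndH := by
  refine le_antisymm (sup_le (fun S h ↦ h.1) fun S h ↦ h.1) fun S hS ↦ ?_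
  have hC : a.φ ∘ₗ S ∘ₗ a.φ ∈ a.EndH := ⟨by simp, by simp⟩
  have h1 := Submodule.smul_mem _ (1 / 2 : ℝ) (sub_mem hS hC)
  have h2 := Submodule.smul_mem _ (1 / 2 : ℝ) (add_mem hS hC)
  refine Submodule.mem_sup.2 ⟨_, ⟨h1, fun X ↦ ?_⟩, _, ⟨h2, fun X ↦ ?_⟩, ?_⟩
  · simp [a.φ_sq, hS.1, hS.2]
    module
  · simp [a.φ_sq, hS.1, hS.2]
    module
  · module

theorem C5_sup_C8 {n : ℕ} (hn : Module.finrank ℝ V = 2 * n + 1) :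
    a.C5 n ⊔ a.C8 = (a.EndSym (-1) ⊓ a.EndComm 1).map a.ofEnd := by
  rw [a.C5_eq hn, a.C8_eq, ← Submodule.map_sup, a.span_φ_sup hn]

theorem C6_sup_C7 {n : ℕ} (hn : Module.finrank ℝ V = 2 * n + 1) :
    a.C6 n ⊔ a.C7 = (a.EndSym 1 ⊓ a.EndComm 1).map a.ofEnd := by
  rw [a.C6_eq hn, a.C7_eq, ← Submodule.map_sup, a.span_proj_sup hn]

theorem C9_sup_C10 : a.C9 ⊔ a.C10 = (a.EndComm (-1)).map a.ofEnd := by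
  rw [a.C9_eq, a.C10_eq, ← Submodule.map_sup, a.EndSym_sup (by norm_num)]

/-- Regrouped, the four classes are the symmetric half `C6 ⊔ C7` and the skew half `C5 ⊔ C8` of the
commuting endomorphisms. -/
theorem C5to8_eq {n : ℕ} (hn : Module.finrank ℝ V = 2 * n + 1) :
    a.C5to8 n = (a.EndComm 1).map a.ofEnd := by
  have h : a.C5to8 n = (a.C6 n ⊔ a.C7) ⊔ (a.C5 n ⊔ a.C8) := by
    rw [C5to8]
    ac_rfl
  rw [h, a.C6_sup_C7 hn, a.C5_sup_C8 hn, ← Submodule.map_sup, a.EndSym_sup (by norm_num)]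

theorem C5to10_eq {n : ℕ} (hn : Module.finrank ℝ V = 2 * n + 1) :
    a.C5to10 n = a.EndH.map a.ofEnd := by
  have h : a.C5to10 n = a.C5to8 n ⊔ (a.C9 ⊔ a.C10) := by
    rw [C5to10, C5to8]
    ac_rfl
  rw [h, a.C5to8_eq hn, a.C9_sup_C10, ← Submodule.map_sup, a.EndComm_sup]

theorem D2_eq {n : ℕ} (hn : Module.finrank ℝ V = 2 * n + 1) :
    a.D2 n = a.EndH.map a.ofEnd ⊔ a.C11 := by
  rw [← a.C5to10_eq hn]
  rfl

/-! ### Orthogonality -/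

theorem _root_.ACM.tensorInner_comm (α β : Tensor3 V) : tensorInner α β = tensorInner β α := by
  simp only [tensorInner, mul_comm]

/-- Contracting the basis against `η` and `S eᵢ` rebuilds `ξ` and `S eᵢ`. The two terms of `ofEnd S`
contribute equally because `γ` is skew in its last two slots, whence the factor `2`. -/
theorem tensorInner_ofEnd {S : V →ₗ[ℝ] V} {γ : Tensor3 V} (hγ : γ ∈ a.CV) :
    tensorInner (a.ofEnd S) γ = 2 * ∑ i, γ (stdOrthonormalBasis ℝ V i) a.ξ
      (S (stdOrthonormalBasis ℝ V i)) := by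
  rw [tensorInner, Finset.mul_sum]
  refine Finset.sum_congr rfl fun i _ ↦ ?_
  set e := stdOrthonormalBasis ℝ V
  have hξ : ∑ j, a.η (e j) • e j = a.ξ := by
    simp_rw [← inner_ξ]
    exact e.sum_repr' a.ξ
  have hS : ∑ j, inner ℝ (S (e i)) (e j) • e j = S (e i) := by
    simp_rw [real_inner_comm]
    exact e.sum_repr' _
  have h1 : ∑ j, ∑ k, a.η (e j) * inner ℝ (S (e i)) (e k) * γ (e i) (e j) (e k) =
      γ (e i) a.ξ (S (e i)) := by
    have h (Z : V) : γ (e i) a.ξ Z = ∑ j, a.η (e j) * γ (e i) (e j) Z := by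
      rw [← hξ]
      simp
    rw [h]
    refine Finset.sum_congr rfl fun j _ ↦ ?_
    nth_rw 2 [← hS]
    rw [map_sum, Finset.mul_sum]
    refine Finset.sum_congr rfl fun k _ ↦ ?_
    simp
    ring
  have h2 : ∑ j, ∑ k, a.η (e k) * inner ℝ (S (e i)) (e j) * γ (e i) (e j) (e k) =
      -γ (e i) a.ξ (S (e i)) := by
    rw [← h1, Finset.sum_comm, ← Finset.sum_neg_distrib]
    refine Finset.sum_congr rfl fun j _ ↦ ?_
    rw [← Finset.sum_neg_distrib]
    refine Finset.sum_congr rfl fun k _ ↦ ?_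
    rw [a.CV_skew hγ]
    ring
  simp only [ofEnd_apply, sub_mul, Finset.sum_sub_distrib, h1, h2]
  ring

/-- Up to the factor `2`, this is the trace inner product of endomorphisms, so orthogonality of
classes reduces to vanishing of traces. -/
theorem tensorInner_ofEnd_ofEnd {S S' : V →ₗ[ℝ] V} (hS' : S' ∈ a.EndTo) :
    tensorInner (a.ofEnd S) (a.ofEnd S') = 2 * LinearMap.trace ℝ V (S'.adjoint ∘ₗ S) := by
  rw [a.tensorInner_ofEnd (a.ofEnd_mem_CV hS'),
    LinearMap.trace_eq_sum_inner _ (stdOrthonormalBasis ℝ V)]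
  congr 1
  refine Finset.sum_congr rfl fun i _ ↦ ?_
  rw [a.ofEnd_ξ hS', LinearMap.comp_apply, LinearMap.adjoint_inner_right]

/-- A tensor in `C11` vanishes when `ξ` is in its second slot, since `φξ = 0`. -/
theorem tensorInner_ofEnd_C11 (S : V →ₗ[ℝ] V) {γ : Tensor3 V} (hγ : γ ∈ a.C11) :
    tensorInner (a.ofEnd S) γ = 0 := by
  rw [a.tensorInner_ofEnd hγ.1, Finset.sum_eq_zero, mul_zero]
  intro i _
  rw [hγ.2]
  simp

theorem _root_.ACM.trace_adjoint_eq (S : V →ₗ[ℝ] V) :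
    LinearMap.trace ℝ V S.adjoint = LinearMap.trace ℝ V S := by
  rw [LinearMap.trace_eq_sum_inner _ (stdOrthonormalBasis ℝ V),
    LinearMap.trace_eq_sum_inner _ (stdOrthonormalBasis ℝ V)]
  refine Finset.sum_congr rfl fun i _ ↦ ?_
  rw [LinearMap.adjoint_inner_right, real_inner_comm]

theorem adjoint_eq_of_mem_EndSym {ε : ℝ} {S : V →ₗ[ℝ] V} (hS : S ∈ a.EndSym ε) :
    S.adjoint = ε • S := by
  ext X
  refine ext_inner_right ℝ fun Z ↦ ?_
  rw [LinearMap.adjoint_inner_left, LinearMap.smul_apply, real_inner_smul_left,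
    real_inner_comm, hS.2, real_inner_comm]

/-- Taking adjoints and using cyclicity, `tr(S'S) = tr(S*S'*) = -tr(SS') = -tr(S'S)`. -/
theorem orth_EndSym {S S' : V →ₗ[ℝ] V} (hS : S ∈ a.EndSym 1) (hS' : S' ∈ a.EndSym (-1)) :
    tensorInner (a.ofEnd S) (a.ofEnd S') = 0 := by
  have h : LinearMap.trace ℝ V (S' ∘ₗ S) = -LinearMap.trace ℝ V (S' ∘ₗ S) := by
    nth_rw 1 [← trace_adjoint_eq]
    rw [LinearMap.adjoint_comp, a.adjoint_eq_of_mem_EndSym hS, a.adjoint_eq_of_mem_EndSym hS',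
      one_smul, LinearMap.comp_smul, map_smul, LinearMap.trace_comp_comm', neg_smul, one_smul]
  rw [a.tensorInner_ofEnd_ofEnd hS'.1.2, a.adjoint_eq_of_mem_EndSym hS', LinearMap.smul_comp,
    map_smul, smul_eq_mul]
  linarith

/-- With `T = S'*`, write `TS = -(TSφ)φ`. Cyclicity turns its trace into `-tr(φTSφ)`, and `φTSφ =
-TφSφ = TS`, so the trace equals its own negative. -/
theorem orth_EndComm {S S' : V →ₗ[ℝ] V} (hS : S ∈ a.EndComm 1) (hS' : S' ∈ a.EndComm (-1)) :
    tensorInner (a.ofEnd S) (a.ofEnd S') = 0 := by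
  rw [a.tensorInner_ofEnd_ofEnd hS'.1.2]
  have hT := a.adjoint_mem_EndComm (by norm_num) hS'
  set T := S'.adjoint
  have h : T ∘ₗ S = -((T ∘ₗ S ∘ₗ a.φ) ∘ₗ a.φ) := by
    ext X
    simp [a.φ_sq, hS.1.1]
  have h' : a.φ ∘ₗ T ∘ₗ S ∘ₗ a.φ = T ∘ₗ S := by
    ext X
    have h1 := hT.2 (S (a.φ X))
    rw [hS.2 X, one_smul, a.φ_sq, hS.1.2] at h1
    simpa [hS.2 X] using h1.symm
  have h2 : LinearMap.trace ℝ V (T ∘ₗ S) = -LinearMap.trace ℝ V (T ∘ₗ S) := by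
    nth_rw 1 [h]
    rw [map_neg, LinearMap.trace_comp_comm', h']
  linarith

/-- `S*S'` is the rank one map `η ⊗ S*(S'ξ)`, whose trace is `η(S*(S'ξ)) = 0`. -/
theorem orth_EndRank {S S' : V →ₗ[ℝ] V} (hS : S ∈ a.EndH) (hS' : S' ∈ a.EndRank) :
    tensorInner (a.ofEnd S') (a.ofEnd S) = 0 := by
  rw [a.tensorInner_ofEnd_ofEnd hS.2]
  have h : S.adjoint ∘ₗ S' = a.η.smulRight (S.adjoint (S' a.ξ)) := by
    ext X
    rw [LinearMap.comp_apply, hS'.2 X, map_smul, LinearMap.smulRight_apply]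
  rw [h, LinearMap.trace_smulRight, (a.adjoint_mem_EndH hS).2, mul_zero]

/-- Because `φ* = -φ`, the condition `tr(φS') = 0` is precisely orthogonality to `φ`. -/
theorem orth_C5_C8 {S S' : V →ₗ[ℝ] V} (hS : S ∈ Submodule.span ℝ {a.φ})
    (hS' : S' ∈ a.EndTrφ) :
    tensorInner (a.ofEnd S') (a.ofEnd S) = 0 := by
  obtain ⟨c, rfl⟩ := Submodule.mem_span_singleton.1 hS
  have h := Submodule.smul_mem _ c a.φ_mem_EndSym
  rw [a.tensorInner_ofEnd_ofEnd h.1.2, a.adjoint_eq_of_mem_EndSym h, LinearMap.smul_comp,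
    LinearMap.smul_comp, map_smul, map_smul, a.mem_EndTrφ.1 hS', smul_zero, smul_zero, mul_zero]

theorem orth_C6_C7 {S S' : V →ₗ[ℝ] V} (hS : S ∈ Submodule.span ℝ {a.proj})
    (hS' : S' ∈ EndTr) (hH : S' ∈ a.EndH) :
    tensorInner (a.ofEnd S') (a.ofEnd S) = 0 := by
  obtain ⟨c, rfl⟩ := Submodule.mem_span_singleton.1 hS
  have h := Submodule.smul_mem _ c a.proj_mem_EndSym
  have h1 : a.proj ∘ₗ S' = S' := by
    ext X
    simp [hH.2]
  rw [a.tensorInner_ofEnd_ofEnd h.1.2, a.adjoint_eq_of_mem_EndSym h, LinearMap.smul_comp,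
    LinearMap.smul_comp, map_smul, map_smul, h1, LinearMap.mem_ker.1 hS', smul_zero, smul_zero,
    mul_zero]

/-- The classes `𝒞_5, …, 𝒞_12` are mutually orthogonal. -/
theorem orthogonal_classes {n : ℕ} (hn : Module.finrank ℝ V = 2 * n + 1) {i j : Fin 8}
    (hij : i ≠ j) {α β : Tensor3 V}
    (hα : α ∈ (![a.C5 n, a.C6 n, a.C7, a.C8, a.C9, a.C10, a.C11, a.C12] :
      Fin 8 → Submodule ℝ (Tensor3 V)) i)
    (hβ : β ∈ (![a.C5 n, a.C6 n, a.C7, a.C8, a.C9, a.C10, a.C11, a.C12] :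
      Fin 8 → Submodule ℝ (Tensor3 V)) j) :
    tensorInner α β = 0 := by
  wlog hlt : i < j generalizing i j α β
  · rw [tensorInner_comm]
    exact this hij.symm hβ hα (lt_of_le_of_ne (not_lt.1 hlt) hij.symm)
  have h5 : Submodule.span ℝ {a.φ} ≤ a.EndSym (-1) ⊓ a.EndComm 1 := by
    simpa using ⟨a.φ_mem_EndSym, a.φ_mem_EndComm⟩
  have h6 : Submodule.span ℝ {a.proj} ≤ a.EndSym 1 ⊓ a.EndComm 1 := by
    simpa using ⟨a.proj_mem_EndSym, a.proj_mem_EndComm⟩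
  rw [a.C5_eq hn, a.C6_eq hn, a.C7_eq, a.C8_eq, a.C9_eq, a.C10_eq, a.C12_eq] at hα hβ
  by_cases h12 : j = 7
  · subst h12
    obtain ⟨S', hS', rfl⟩ := hβ
    by_cases h11 : i = 6
    · subst h11
      rw [tensorInner_comm]
      exact a.tensorInner_ofEnd_C11 S' hα
    rw [tensorInner_comm]
    fin_cases i <;> first | exact absurd rfl h11 | exact absurd rfl hij | skip
    all_goals obtain ⟨S, hS, rfl⟩ := hα
    · exact a.orth_EndRank (h5 hS).1.1 hS'
    · exact a.orth_EndRank (h6 hS).1.1 hS'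
    · exact a.orth_EndRank hS.1.1.1 hS'
    · exact a.orth_EndRank hS.1.1.1 hS'
    · exact a.orth_EndRank hS.1.1 hS'
    · exact a.orth_EndRank hS.1.1 hS'
  by_cases h11 : j = 6
  · subst h11
    fin_cases i <;> first | exact absurd hlt (by decide) | skip
    all_goals
      obtain ⟨S, hS, rfl⟩ := hα
      exact a.tensorInner_ofEnd_C11 S hβ
  -- The remaining pairs lie among `C5, …, C10`. They are separated by symmetry against skewness, by
  -- commuting against anticommuting, or, for `C5, C8` and `C6, C7`, by the trace condition.
  fin_cases j <;> first | exact absurd rfl h11 | exact absurd rfl h12 | skip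
  all_goals fin_cases i <;> first | exact absurd hlt (by decide) | skip
  all_goals
    obtain ⟨S, hS, rfl⟩ := hα
    obtain ⟨S', hS', rfl⟩ := hβ
  · rw [tensorInner_comm]
    exact a.orth_EndSym (h6 hS').1 (h5 hS).1
  · rw [tensorInner_comm]
    exact a.orth_EndSym hS'.1.1 (h5 hS).1
  · rw [tensorInner_comm]
    exact a.orth_C6_C7 hS hS'.2 hS'.1.1.1
  · rw [tensorInner_comm]
    exact a.orth_C5_C8 hS hS'.2
  · exact a.orth_EndSym (h6 hS).1 hS'.1.1
  · exact a.orth_EndSym hS.1.1 hS'.1.1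
  · exact a.orth_EndComm (h5 hS).2 hS'.2
  · exact a.orth_EndComm (h6 hS).2 hS'.2
  · exact a.orth_EndComm hS.1.2 hS'.2
  · exact a.orth_EndComm hS.1.2 hS'.2
  · exact a.orth_EndComm (h5 hS).2 hS'.2
  · exact a.orth_EndComm (h6 hS).2 hS'.2
  · exact a.orth_EndComm hS.1.2 hS'.2
  · exact a.orth_EndComm hS.1.2 hS'.2
  · exact a.orth_EndSym hS.1 hS'.1

end Sums

end LinearStructure

end

end ACM

/-! ### Pointwise criteria in terms of `S`, `F` and `h` -/

namespace ACM

noncomputable section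

namespace LinearStructure

section Pointwise

variable {V : Type*} [NormedAddCommGroup V] [InnerProductSpace ℝ V] [FiniteDimensional ℝ V]
  {a : LinearStructure V}

/-- The endomorphisms `S = φ ∘ ∇ξ`, `F = ∇_ξ φ` and `h = ½ ℒ_ξ φ` determined by a tensor
`α = ∇Φ`. -/
structure Represents (a : LinearStructure V) (α : Tensor3 V) (S F h : V →ₗ[ℝ] V) : Prop where
  mem_CV : α ∈ a.CV
  apply_ξ : ∀ X Z, α X a.ξ Z = inner ℝ (S X) Z
  ξ_apply : ∀ X Y, α a.ξ Y X = inner ℝ Y (F X)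
  two_h : ∀ X, (2 : ℝ) • h X = F X + a.φ (S (a.φ X)) + S X

/-- `α` vanishes on horizontal vectors. -/
def IsHZero (a : LinearStructure V) (α : Tensor3 V) : Prop :=
  ∀ X Y Z, a.η X = 0 → a.η Y = 0 → a.η Z = 0 → α X Y Z = 0

/-- The exterior derivative `dη` in terms of `S`. -/
def extEta (a : LinearStructure V) (S : V →ₗ[ℝ] V) (X Y : V) : ℝ :=
  inner ℝ (S X) (a.φ Y) - inner ℝ (S Y) (a.φ X)

/-- The exterior derivative `dΦ` in terms of `α = ∇Φ`. -/
def extPhi (α : Tensor3 V) (X Y Z : V) : ℝ := α X Y Z + α Y Z X + α Z X Y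

/-- The component along `W` of `[φ, φ] + dη ⊗ ξ` in terms of `α = ∇Φ`. -/
def nij (a : LinearStructure V) (α : Tensor3 V) (S : V →ₗ[ℝ] V) (X Y W : V) : ℝ :=
  α (a.φ X) W Y - α (a.φ Y) W X + α X (a.φ W) Y - α Y (a.φ W) X + a.extEta S X Y * a.η W

variable {α : Tensor3 V} {S F h : V →ₗ[ℝ] V}

theorem η_sub_smul (a : LinearStructure V) (X : V) : a.η (X - a.η X • a.ξ) = 0 := by
  simp [a.η_ξ]

namespace Represents

variable (r : a.Represents α S F h)
include r

theorem mem_EndTo : S ∈ a.EndTo := fun X ↦ by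
  rw [← inner_ξ, ← r.apply_ξ, a.CV_ξ_ξ r.mem_CV]

theorem apply_ξ_right (X Y : V) : α X Y a.ξ = -inner ℝ (S X) Y := by
  rw [a.CV_skew r.mem_CV, r.apply_ξ]

theorem inner_F (X Y : V) : inner ℝ Y (F X) =
    a.η Y * inner ℝ (S a.ξ) X - a.η X * inner ℝ (S a.ξ) Y - α a.ξ (a.φ Y) (a.φ X) := by
  rw [← r.ξ_apply, (r.mem_CV a.ξ Y X).2, r.apply_ξ, r.apply_ξ_right]
  ring

theorem F_skew (X Y : V) : inner ℝ (F X) Y = -inner ℝ X (F Y) := by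
  rw [real_inner_comm, ← r.ξ_apply, ← r.ξ_apply, a.CV_skew r.mem_CV]

/-- Vanishing on the horizontal part of `X` together with `φY`, `φZ` says `α(X,φY,φZ) = η(X)
α(ξ,φY,φZ)`. The second symmetry of `CV` expresses `α(X,Y,Z)` through this and two terms in `S`. -/
theorem isHZero_iff : a.IsHZero α ↔
    ∀ X Y Z, α X Y Z = a.ofEnd S X Y Z - a.η X * α a.ξ (a.φ Y) (a.φ Z) := by
  constructor
  · intro hz X Y Z
    have h1 := hz (X - a.η X • a.ξ) (a.φ Y) (a.φ Z) (a.η_sub_smul X) (a.η_φ Y) (a.η_φ Z)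
    rw [map_sub, map_smul, LinearMap.sub_apply, LinearMap.sub_apply, LinearMap.smul_apply,
      LinearMap.smul_apply, smul_eq_mul] at h1
    rw [(r.mem_CV X Y Z).2, r.apply_ξ, r.apply_ξ_right, ofEnd_apply]
    linarith
  · intro h1 X Y Z hX hY hZ
    rw [h1, ofEnd_apply, hX, hY, hZ]
    ring

theorem eq_ofEnd_iff (hz : a.IsHZero α) :
    α = a.ofEnd S ↔ ∀ Y Z, α a.ξ (a.φ Y) (a.φ Z) = 0 := by
  constructor
  · intro h1 Y Z
    rw [h1, ofEnd_apply, η_φ, η_φ]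
    ring
  · intro h1
    ext X Y Z
    rw [r.isHZero_iff.1 hz, h1, mul_zero, sub_zero]

/-- Once `Sξ = 0`, `inner_F` reduces to `⟨Y,FX⟩ = -α(ξ,φY,φX)`, so `F` is the obstruction to `α =
ofEnd S`. -/
theorem eq_ofEnd_iff_F (hz : a.IsHZero α) (hξ : S a.ξ = 0) : α = a.ofEnd S ↔ ∀ X, F X = 0 := by
  rw [r.eq_ofEnd_iff hz]
  constructor
  · intro h1 X
    refine ext_inner_left ℝ fun Y ↦ ?_
    rw [r.inner_F, hξ, h1]
    simp
  · intro h1 Y Z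
    have := r.inner_F Z Y
    rw [hξ, h1] at this
    simpa using this

theorem mem_map_iff {K : Submodule ℝ (V →ₗ[ℝ] V)} (hK : K ≤ a.EndTo) :
    α ∈ K.map a.ofEnd ↔ S ∈ K ∧ α = a.ofEnd S := by
  constructor
  · rintro ⟨S', hS', h1⟩
    have h2 : S = S' := by
      ext X
      refine ext_inner_right ℝ fun Z ↦ ?_
      rw [← r.apply_ξ, ← h1, a.ofEnd_ξ (hK hS')]
    exact ⟨h2 ▸ hS', by rw [h2, h1]⟩
  · rintro ⟨hS, h1⟩
    exact ⟨S, hS, h1.symm⟩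

/-- The common reduction for every class inside `C5 ⊕ ⋯ ⊕ C10`: a linear condition on `S`, and `F =
0`. -/
theorem mem_map_iff_F (hz : a.IsHZero α) {K : Submodule ℝ (V →ₗ[ℝ] V)} (hK : K ≤ a.EndH) :
    α ∈ K.map a.ofEnd ↔ S ∈ K ∧ ∀ X, F X = 0 := by
  rw [r.mem_map_iff (hK.trans a.EndH_le_EndTo)]
  exact and_congr_right fun hS ↦ r.eq_ofEnd_iff_F hz (hK hS).1

theorem mem_EndH (hξ : S a.ξ = 0) : S ∈ a.EndH := ⟨hξ, r.mem_EndTo⟩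

/-- Both sides pair with `Y` to `-α(ξ,φY,φX)`. Equivalently `F` anticommutes with `φ`, a constraint
used below to force `F = 0`. -/
theorem φ_F_φ (hξ : S a.ξ = 0) (X : V) : a.φ (F (a.φ X)) = F X := by
  refine ext_inner_left ℝ fun Y ↦ ?_
  rw [← neg_inj, ← inner_φ_left, ← r.ξ_apply, r.inner_F, hξ]
  simp

theorem η_F (hξ : S a.ξ = 0) (X : V) : a.η (F X) = 0 := by
  rw [← inner_ξ_left, ← r.ξ_apply, r.apply_ξ, hξ, inner_zero_left]

/-! ### Membership in the classes -/

theorem mem_C11_iff (hz : a.IsHZero α) : α ∈ a.C11 ↔ ∀ X, S X = 0 := by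
  constructor
  · intro h1 X
    refine ext_inner_right ℝ fun Z ↦ ?_
    rw [← r.apply_ξ, h1.2]
    simp
  · intro h1
    refine ⟨r.mem_CV, fun X Y Z ↦ ?_⟩
    rw [r.isHZero_iff.1 hz, ofEnd_apply, h1]
    simp

/-- Vanishing of `S` on `ℋ` makes `S = η ⊗ Sξ`; what remains is to see that `φh` then measures
exactly the `C11` part. -/
theorem mem_C12_iff (hz : a.IsHZero α) :
    α ∈ a.C12 ↔ (∀ X, a.η X = 0 → S X = 0) ∧ ∀ X, a.φ (h X) = 0 := by
  rw [a.C12_eq, r.mem_map_iff (K := a.EndRank) fun _ h1 ↦ h1.1, r.eq_ofEnd_iff hz]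
  have h1 : S ∈ a.EndRank ↔ ∀ X, a.η X = 0 → S X = 0 := by
    constructor
    · intro h1 X hX
      rw [h1.2, hX, zero_smul]
    · intro h1
      refine ⟨r.mem_EndTo, fun X ↦ ?_⟩
      have := h1 _ (a.η_sub_smul X)
      rwa [map_sub, map_smul, sub_eq_zero] at this
  rw [h1]
  refine and_congr_right fun h2 ↦ ?_
  -- Here `Sφ = 0`, so `2h = F + S`. Paired with `φY`, the term `η(X)⟨Sξ,φY⟩` of `S` cancels the one
  -- in `inner_F`.
  have h3 (X Y) : 2 * inner ℝ Y (a.φ (h X)) = α a.ξ (a.φ (a.φ Y)) (a.φ X) := by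
    have h4 : S X = a.η X • S a.ξ := (h1.2 h2).2 X
    rw [← neg_inj, ← mul_neg, ← inner_φ_left, ← real_inner_smul_right, r.two_h, h2 _ (a.η_φ X),
      map_zero, add_zero, inner_add_right, r.inner_F, a.η_φ, h4, real_inner_smul_right,
      real_inner_comm (S a.ξ)]
    ring
  constructor
  · intro h4 X
    refine ext_inner_left ℝ fun Y ↦ ?_
    have := h3 X Y
    rw [h4] at this
    simpa using this
  · intro h4 Y Z
    have := h3 Z (a.φ Y)
    rw [h4, a.φ_sq, map_add, map_neg, map_smul] at this
    simpa using this

theorem remainder_mem_C11 (hz : a.IsHZero α) : α + (-1 : ℝ) • a.ofEnd S ∈ a.C11 := by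
  refine ⟨add_mem r.mem_CV (Submodule.smul_mem _ _ (a.ofEnd_mem_CV r.mem_EndTo)), fun X Y Z ↦ ?_⟩
  simp only [LinearMap.add_apply, LinearMap.smul_apply]
  rw [r.isHZero_iff.1 hz X, a.ofEnd_apply S a.ξ, a.η_φ, a.η_φ, smul_eq_mul]
  ring

/-- Both summands of `D2` vanish on `(ξ, ξ, Z)`, which gives `Sξ = 0`; conversely `α` is `ofEnd S`
plus its remainder in `C11`. -/
theorem mem_D2_iff {n : ℕ} (hn : Module.finrank ℝ V = 2 * n + 1) (hz : a.IsHZero α) :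
    α ∈ a.D2 n ↔ S a.ξ = 0 := by
  rw [a.D2_eq hn]
  constructor
  · intro h1
    obtain ⟨_, ⟨S', hS', rfl⟩, γ, hγ, rfl⟩ := Submodule.mem_sup.1 h1
    refine ext_inner_right ℝ fun Z ↦ ?_
    rw [← r.apply_ξ, LinearMap.add_apply, LinearMap.add_apply, LinearMap.add_apply,
      a.ofEnd_ξ hS'.2, hS'.1, hγ.2]
    simp
  · intro h1
    exact Submodule.mem_sup.2 ⟨_, ⟨S, r.mem_EndH h1, rfl⟩, _, r.remainder_mem_C11 hz, by module⟩

/-- `ℋ`-parallelism is membership in `𝒟_2 ⊕ 𝒟_3`. -/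
theorem isHZero_iff_mem {n : ℕ} (hn : Module.finrank ℝ V = 2 * n + 1) :
    a.IsHZero α ↔ α ∈ a.D2 n ⊔ a.D3 := by
  rw [a.D2_eq hn, D3, a.C12_eq]
  constructor
  · intro hz
    -- The rank one part `η ⊗ Sξ` accounts for `C12`, and `S - R` kills `ξ`.
    let R : V →ₗ[ℝ] V := a.η.smulRight (S a.ξ)
    have hR : R ∈ a.EndRank := ⟨fun X ↦ by simp [R, r.mem_EndTo a.ξ], fun X ↦ by simp [R, a.η_ξ]⟩
    have hS : S - R ∈ a.EndH :=
      ⟨by simp [R, a.η_ξ], fun X ↦ by simp [R, r.mem_EndTo X, r.mem_EndTo a.ξ]⟩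
    refine Submodule.mem_sup.2 ⟨_, Submodule.mem_sup.2 ⟨_, ⟨S - R, hS, rfl⟩,
      _, r.remainder_mem_C11 hz, rfl⟩, _, ⟨R, hR, rfl⟩, ?_⟩
    ext X Y Z
    simp only [LinearMap.add_apply, LinearMap.smul_apply, ofEnd_apply, LinearMap.sub_apply,
      inner_sub_left, smul_eq_mul]
    ring
  · intro h1 X Y Z hX hY hZ
    obtain ⟨_, h2, _, ⟨S'', -, rfl⟩, rfl⟩ := Submodule.mem_sup.1 h1
    obtain ⟨_, ⟨S', -, rfl⟩, γ, hγ, rfl⟩ := Submodule.mem_sup.1 h2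
    simp only [LinearMap.add_apply]
    rw [ofEnd_apply, ofEnd_apply, hγ.2, hX, hY, hZ]
    ring

/-- Here `φSφ = -S`, so `2h = F`. -/
theorem F_eq_zero_iff_comm (hS : S ∈ a.EndComm 1) : (∀ X, F X = 0) ↔ ∀ X, h X = 0 := by
  refine forall_congr' fun X ↦ ?_
  have h1 := r.two_h X
  rw [a.mem_EndComm_iff hS.1 |>.1 hS, one_smul, neg_add_cancel_right] at h1
  rw [← h1, smul_eq_zero, or_iff_right two_ne_zero]

/-- Here `φSφ = S`, so `2h = F + 2S`. -/
theorem F_eq_zero_iff_anti (hS : S ∈ a.EndComm (-1)) : (∀ X, F X = 0) ↔ ∀ X, h X = S X := by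
  refine forall_congr' fun X ↦ ?_
  have h1 := r.two_h X
  rw [a.mem_EndComm_iff hS.1 |>.1 hS, neg_smul, one_smul, neg_neg, add_assoc, ← two_smul ℝ (S X),
    ← sub_eq_iff_eq_add, ← smul_sub] at h1
  rw [← h1, smul_eq_zero, or_iff_right two_ne_zero, sub_eq_zero]

theorem comm_iff_h (hξ : S a.ξ = 0) (hF : ∀ X, F X = 0) : S ∈ a.EndComm 1 ↔ ∀ X, h X = 0 := by
  refine ⟨fun hS ↦ (r.F_eq_zero_iff_comm hS).1 hF, fun h1 ↦ ?_⟩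
  refine (a.mem_EndComm_iff (r.mem_EndH hξ)).2 fun X ↦ ?_
  have := r.two_h X
  rw [h1, hF, zero_add, smul_zero] at this
  rw [one_smul]
  exact eq_neg_of_add_eq_zero_left this.symm

theorem anti_iff_h (hξ : S a.ξ = 0) (hF : ∀ X, F X = 0) :
    S ∈ a.EndComm (-1) ↔ ∀ X, h X = S X := by
  refine ⟨fun hS ↦ (r.F_eq_zero_iff_anti hS).1 hF, fun h1 ↦ ?_⟩
  refine (a.mem_EndComm_iff (r.mem_EndH hξ)).2 fun X ↦ ?_
  have := r.two_h X
  rw [h1, hF, zero_add, two_smul, add_left_inj] at this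
  rw [neg_smul, one_smul, neg_neg, this]

omit r in
-- Testing on horizontal vectors suffices, because `S` kills `ξ` and its range is orthogonal to `ξ`.
theorem mem_EndSym_iff_isSymmOnH : S ∈ a.EndSym 1 ↔ a.IsSymmOnH S := by
  refine ⟨fun h1 ↦ ⟨h1.1.1, h1.1.2, fun X Y _ _ ↦ by rw [h1.2, one_mul]⟩,
    fun ⟨h1, h2, h3⟩ ↦ ⟨⟨h1, h2⟩, fun X Y ↦ ?_⟩⟩
  have := h3 _ _ (a.η_sub_smul X) (a.η_sub_smul Y)
  simpa [h1, inner_sub_left, inner_sub_right, real_inner_smul_left, real_inner_smul_right,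
    inner_ξ, inner_ξ_left, h2] using this

omit r in
theorem mem_EndSym_iff_isSkewOnH : S ∈ a.EndSym (-1) ↔ a.IsSkewOnH S := by
  refine ⟨fun h1 ↦ ⟨h1.1.1, h1.1.2, fun X Y _ _ ↦ by rw [h1.2, neg_one_mul]⟩,
    fun ⟨h1, h2, h3⟩ ↦ ⟨⟨h1, h2⟩, fun X Y ↦ ?_⟩⟩
  have := h3 _ _ (a.η_sub_smul X) (a.η_sub_smul Y)
  simpa [h1, inner_sub_left, inner_sub_right, real_inner_smul_left, real_inner_smul_right,
    inner_ξ, inner_ξ_left, h2] using this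

theorem mem_C5_iff_F {n : ℕ} (hn : Module.finrank ℝ V = 2 * n + 1) (hz : a.IsHZero α) :
    α ∈ a.C5 n ↔ (∃ β : ℝ, ∀ X, S X = β • a.φ X) ∧ ∀ X, F X = 0 := by
  rw [a.C5_eq hn, r.mem_map_iff_F hz (by simpa using a.φ_mem_EndH), Submodule.mem_span_singleton]
  refine and_congr_left fun _ ↦ exists_congr fun β ↦ ?_
  rw [eq_comm, LinearMap.ext_iff]
  rfl

theorem mem_C6_iff_F {n : ℕ} (hn : Module.finrank ℝ V = 2 * n + 1) (hz : a.IsHZero α) :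
    α ∈ a.C6 n ↔ (∃ β : ℝ, ∀ X, S X = β • (X - a.η X • a.ξ)) ∧ ∀ X, F X = 0 := by
  rw [a.C6_eq hn, r.mem_map_iff_F hz (by simpa using a.proj_mem_EndH),
    Submodule.mem_span_singleton]
  refine and_congr_left fun _ ↦ exists_congr fun β ↦ ?_
  rw [eq_comm, LinearMap.ext_iff]
  simp only [LinearMap.smul_apply, proj_apply]

omit r in
-- The trace determines the scalar: `tr(φS) = -2nβ`. For `n = 0` any scalar works, since `φ = 0`.
theorem exists_smul_φ_iff {n : ℕ} (hn : Module.finrank ℝ V = 2 * n + 1) :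
    (∃ β : ℝ, ∀ X, S X = β • a.φ X) ↔
      ∀ X, S X = (-(1 / (2 * n : ℝ)) * LinearMap.trace ℝ V (a.φ ∘ₗ S)) • a.φ X := by
  refine ⟨fun ⟨β, h1⟩ X ↦ ?_, fun h1 ↦ ⟨_, h1⟩⟩
  rcases eq_or_ne n 0 with h0 | h0
  · rw [h1, a.eq_zero_of_finrank_one hn h0 a.φ_mem_EndH]
    simp
  have : (n : ℝ) ≠ 0 := by exact_mod_cast h0
  have h2 : S = β • a.φ := LinearMap.ext h1
  rw [h1, h2, LinearMap.comp_smul, map_smul, a.trace_φ_φ hn, smul_eq_mul]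
  congr 1
  field_simp

omit r in
theorem exists_smul_proj_iff {n : ℕ} (hn : Module.finrank ℝ V = 2 * n + 1) :
    (∃ β : ℝ, ∀ X, S X = β • (X - a.η X • a.ξ)) ↔
      ∀ X, S X = (1 / (2 * n : ℝ) * LinearMap.trace ℝ V S) • (X - a.η X • a.ξ) := by
  refine ⟨fun ⟨β, h1⟩ X ↦ ?_, fun h1 ↦ ⟨_, h1⟩⟩
  rcases eq_or_ne n 0 with h0 | h0
  · rw [h1, ← proj_apply, a.eq_zero_of_finrank_one hn h0 a.proj_mem_EndH]
    simp
  have : (n : ℝ) ≠ 0 := by exact_mod_cast h0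
  have h2 : S = β • a.proj := by
    ext X
    simp [h1]
  rw [h1, h2, map_smul, a.trace_proj hn, smul_eq_mul]
  congr 1
  field_simp

omit r in
theorem comm_of_smul_φ {β : ℝ} (h1 : ∀ X, S X = β • a.φ X) :
    S ∈ a.EndSym (-1) ⊓ a.EndComm 1 := by
  have h2 : S = β • a.φ := LinearMap.ext h1
  rw [h2]
  exact Submodule.smul_mem _ β ⟨a.φ_mem_EndSym, a.φ_mem_EndComm⟩

omit r in
theorem comm_of_smul_proj {β : ℝ} (h1 : ∀ X, S X = β • (X - a.η X • a.ξ)) :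
    S ∈ a.EndSym 1 ⊓ a.EndComm 1 := by
  have h2 : S = β • a.proj := by
    ext X
    simp [h1]
  rw [h2]
  exact Submodule.smul_mem _ β ⟨a.proj_mem_EndSym, a.proj_mem_EndComm⟩

/-! ### Exterior derivatives and normality -/

/-- Inserting `ξ` in the slots of the normality tensor yields `Sξ = 0`, then `φF = Sφ - φS`, then
symmetry of `φF`. But `φF` is also skew, so it vanishes, and with it both `F` and the commutator. -/
theorem normal_iff (hz : a.IsHZero α) :
    (∀ X Y W, a.nij α S X Y W = 0) ↔ S ∈ a.EndComm 1 ∧ ∀ X, F X = 0 := by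
  constructor
  · intro h1
    have hξ : S a.ξ = 0 := by
      have h2 (X) : inner ℝ (S a.ξ) (a.φ X) = 0 := by
        have := h1 X a.ξ a.ξ
        simpa [nij, extEta, a.η_ξ, a.CV_ξ_ξ r.mem_CV] using this
      refine ext_inner_right ℝ fun Z ↦ ?_
      have := h2 (a.φ Z)
      rw [a.φ_sq, inner_add_right, real_inner_smul_right, inner_ξ, r.mem_EndTo, inner_neg_right]
        at this
      rw [inner_zero_left]
      linarith
    have hH := r.mem_EndH hξ
    -- The tensor evaluated at `Y = ξ`.
    have hB (X) : a.φ (F X) = S (a.φ X) - a.φ (S X) := by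
      refine ext_inner_left ℝ fun W ↦ ?_
      have := h1 X a.ξ W
      simp only [nij, extEta, a.φ_ξ, hξ, r.apply_ξ_right, r.ξ_apply, map_zero, inner_zero_left,
        inner_zero_right, LinearMap.zero_apply] at this
      rw [← neg_inj, ← inner_φ_left, inner_sub_right, real_inner_comm (S (a.φ X)),
        real_inner_comm (a.φ (S X)), a.inner_φ_left (S X)]
      linarith
    -- The component `W = ξ`, rewritten through `hB`.
    have hsymm (X Y) : inner ℝ (a.φ (F X)) Y = inner ℝ (a.φ (F Y)) X := by
      have := h1 X Y a.ξ
      simp only [nij, extEta, a.φ_ξ, r.apply_ξ, map_zero, LinearMap.zero_apply, a.η_ξ] at this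
      rw [hB, hB, inner_sub_left, inner_sub_left, inner_φ_left, inner_φ_left]
      linarith
    have hanti (X) : F (a.φ X) = -a.φ (F X) := by
      have := congrArg a.φ (r.φ_F_φ hξ X)
      rw [a.φ_sq, r.η_F hξ, zero_smul, add_zero] at this
      rw [← this, neg_neg]
    have hφF (X) : a.φ (F X) = 0 := by
      refine ext_inner_right ℝ fun Y ↦ ?_
      have h2 := hsymm X Y
      -- `F` and `φ` are both skew and anticommute, so their product is skew.
      have h3 : inner ℝ (a.φ (F X)) Y = -inner ℝ (a.φ (F Y)) X := by
        rw [inner_φ_left, r.F_skew, hanti, inner_neg_right, real_inner_comm]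
        ring
      rw [inner_zero_left]
      linarith
    refine ⟨⟨hH, fun X ↦ ?_⟩, fun X ↦ ?_⟩
    · rw [one_smul, ← sub_eq_zero, ← hB, hφF]
    · have := a.φ_sq (F X)
      rw [hφF, map_zero, r.η_F hξ, zero_smul, add_zero] at this
      exact neg_eq_zero.1 this.symm
  · rintro ⟨hS, hF⟩ X Y W
    have h1 := (r.eq_ofEnd_iff_F hz hS.1.1).2 hF
    simp only [nij, extEta, h1, ofEnd_apply, a.η_φ, hS.2, one_smul, inner_φ_left]
    ring

/-- The six terms of the cyclic sum cancel in pairs by symmetry of `S`. -/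
theorem extPhi_ofEnd (hS : S ∈ a.EndSym 1) (X Y Z : V) : extPhi (a.ofEnd S) X Y Z = 0 := by
  simp only [extPhi, ofEnd_apply]
  rw [hS.2 X Z, hS.2 Y X, hS.2 Z Y, one_mul, one_mul, one_mul, real_inner_comm X,
    real_inner_comm Y, real_inner_comm Z]
  ring

theorem extPhi_ξ (Y Z : V) :
    extPhi α a.ξ Y Z = inner ℝ Y (F Z) - inner ℝ (S Y) Z + inner ℝ (S Z) Y := by
  rw [extPhi, r.ξ_apply, r.apply_ξ_right, r.apply_ξ]
  ring

theorem S_ξ_of_extEta (h1 : ∀ X Y, a.extEta S X Y = 0) : S a.ξ = 0 := by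
  refine ext_inner_right ℝ fun Z ↦ ?_
  have := h1 a.ξ (a.φ Z)
  rw [extEta, a.φ_sq, inner_add_right, real_inner_smul_right, inner_ξ, r.mem_EndTo,
    inner_neg_right, a.φ_ξ, inner_zero_right] at this
  rw [inner_zero_left]
  linarith

/-- Evaluating `dη = 0` at `(X, φY)` amounts to `S* = φSφ`. -/
theorem inner_S_of_extEta (h1 : ∀ X Y, a.extEta S X Y = 0) (X Y : V) :
    inner ℝ (S X) Y = inner ℝ X (a.φ (S (a.φ Y))) := by
  have := h1 X (a.φ Y)
  rw [extEta, a.φ_sq, inner_add_right, real_inner_smul_right, inner_ξ, r.mem_EndTo,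
    inner_neg_right, ← neg_neg (inner ℝ (S (a.φ Y)) (a.φ X)), ← inner_φ_left,
    real_inner_comm X] at this
  linarith

/-- From `dη = 0` comes `S* = φSφ`, and `dΦ(ξ,·,·) = 0` then reads `F = φSφ - S`. Conjugating this
by `φ` changes its sign while `φFφ = F`, so `F = 0` and `S = φSφ = S*`. -/
theorem almostCokahler_iff (hz : a.IsHZero α) :
    ((∀ X Y, a.extEta S X Y = 0) ∧ ∀ X Y Z, extPhi α X Y Z = 0) ↔
      S ∈ a.EndSym 1 ⊓ a.EndComm (-1) ∧ ∀ X, F X = 0 := by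
  constructor
  · rintro ⟨h1, h2⟩
    have hξ := r.S_ξ_of_extEta h1
    have hH := r.mem_EndH hξ
    have hT := r.inner_S_of_extEta h1
    have hF (X) : F X = a.φ (S (a.φ X)) - S X := by
      refine ext_inner_left ℝ fun Y ↦ ?_
      have := h2 a.ξ Y X
      rw [r.extPhi_ξ, hT Y, real_inner_comm Y] at this
      rw [inner_sub_right]
      linarith
    have hF0 (X) : F X = 0 := by
      have h3 := r.φ_F_φ hξ X
      have h4 : F X = -F X := by
        nth_rw 1 [← h3]
        simp [hF, a.φ_sq, hξ, hH.2]
      rwa [← add_eq_zero_iff_eq_neg, ← two_smul ℝ, smul_eq_zero, or_iff_right two_ne_zero] at h4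
    have hc (X) : a.φ (S (a.φ X)) = S X := by
      rw [← sub_eq_zero, ← hF, hF0]
    refine ⟨⟨⟨hH, fun X Y ↦ by rw [hT, hc, one_mul]⟩, (a.mem_EndComm_iff hH).2 fun X ↦ ?_⟩, hF0⟩
    rw [hc, neg_smul, one_smul, neg_neg]
  · rintro ⟨⟨hS, hc⟩, hF⟩
    refine ⟨fun X Y ↦ ?_, fun X Y Z ↦ ?_⟩
    · rw [extEta, hS.2 X, hc.2, inner_smul_right, ← neg_neg (inner ℝ (S Y) _), ← inner_φ_left,
        real_inner_comm]
      ring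
    · rw [(r.eq_ofEnd_iff_F hz hS.1.1).2 hF, r.extPhi_ofEnd hS]

theorem quasiSasakian_iff (hz : a.IsHZero α) :
    ((∀ X Y W, a.nij α S X Y W = 0) ∧ ∀ X Y Z, extPhi α X Y Z = 0) ↔
      S ∈ a.EndSym 1 ⊓ a.EndComm 1 ∧ ∀ X, F X = 0 := by
  rw [r.normal_iff hz]
  constructor
  · rintro ⟨⟨hS, hF⟩, h2⟩
    refine ⟨⟨⟨hS.1, fun X Y ↦ ?_⟩, hS⟩, hF⟩
    have := h2 a.ξ X Y
    rw [r.extPhi_ξ, hF, inner_zero_right, real_inner_comm X] at this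
    linarith
  · rintro ⟨⟨hS, hc⟩, hF⟩
    refine ⟨⟨hc, hF⟩, fun X Y Z ↦ ?_⟩
    rw [(r.eq_ofEnd_iff_F hz hS.1.1).2 hF, r.extPhi_ofEnd hS]

/-- With `S` commuting, `dη = 0` gives `S* = φSφ = -S`. Hence `dΦ(ξ,X,Y) = -2⟨SX,Y⟩`, to be compared
with `2βΦ(X,Y) = -2β⟨φX,Y⟩`. -/
theorem betaKenmotsu_iff (hz : a.IsHZero α) (β : ℝ) :
    ((∀ X Y W, a.nij α S X Y W = 0) ∧ (∀ X Y, a.extEta S X Y = 0) ∧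
      ∀ X Y Z, extPhi α X Y Z =
        2 * β * (a.η X * a.Phi Y Z + a.η Y * a.Phi Z X + a.η Z * a.Phi X Y)) ↔
      (∀ X, S X = β • a.φ X) ∧ ∀ X, F X = 0 := by
  rw [r.normal_iff hz]
  have hΦ (X Y : V) : a.Phi X Y = -a.Phi Y X := by
    rw [Phi, Phi, real_inner_comm, inner_φ_left]
  constructor
  · rintro ⟨⟨hS, hF⟩, h1, h2⟩
    refine ⟨fun X ↦ ext_inner_right ℝ fun Y ↦ ?_, hF⟩
    have h3 := r.inner_S_of_extEta h1 X Y
    rw [(a.mem_EndComm_iff hS.1).1 hS, one_smul, inner_neg_right] at h3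
    have h4 := h2 a.ξ X Y
    rw [r.extPhi_ξ, hF, inner_zero_right, a.η_ξ] at h4
    have h5 : a.Phi Y a.ξ = 0 := by simp [Phi]
    have h6 : a.Phi a.ξ X = 0 := by rw [hΦ]; simp [Phi]
    rw [h5, h6, Phi, real_inner_comm X] at h4
    rw [real_inner_smul_left, inner_φ_left]
    linarith
  · rintro ⟨h1, hF⟩
    have hS := comm_of_smul_φ h1
    refine ⟨⟨hS.2, hF⟩, fun X Y ↦ ?_, fun X Y Z ↦ ?_⟩
    · rw [extEta, h1, h1, real_inner_smul_left, real_inner_smul_left, real_inner_comm, sub_self]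
    · rw [(r.eq_ofEnd_iff_F hz hS.1.1.1).2 hF]
      have h3 (X Y) : inner ℝ (S X) Y = - β * a.Phi X Y := by
        rw [h1, real_inner_smul_left, inner_φ_left, Phi]
        ring
      simp only [extPhi, ofEnd_apply, h3]
      rw [hΦ X Z, hΦ Y X, hΦ Z Y]
      ring

/-- For `S` symmetric and commuting, `dη(X,Y) = 2⟨SX,φY⟩`; replacing `Y` by `φY` identifies `S` on
`ℋ`. -/
theorem alphaSasakian_iff (hz : a.IsHZero α) (β : ℝ) :
    (((∀ X Y W, a.nij α S X Y W = 0) ∧ ∀ X Y Z, extPhi α X Y Z = 0) ∧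
      ∀ X Y, a.extEta S X Y = 2 * β * a.Phi X Y) ↔
      (∀ X, S X = β • (X - a.η X • a.ξ)) ∧ ∀ X, F X = 0 := by
  rw [r.quasiSasakian_iff hz]
  constructor
  · rintro ⟨⟨⟨hS, hc⟩, hF⟩, h1⟩
    have h3 (X Y) : inner ℝ (S X) (a.φ Y) = β * inner ℝ X (a.φ Y) := by
      have h4 := h1 X Y
      have h5 : inner ℝ (S Y) (a.φ X) = -inner ℝ (S X) (a.φ Y) := by
        rw [hS.2, hc.2, one_smul, one_mul, real_inner_comm, inner_φ_left]
      rw [extEta, Phi, h5] at h4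
      linarith
    refine ⟨fun X ↦ ext_inner_right ℝ fun Y ↦ ?_, hF⟩
    have h4 := h3 X (a.φ Y)
    rw [a.φ_sq, inner_add_right, inner_add_right, real_inner_smul_right, real_inner_smul_right,
      inner_ξ, inner_ξ, hS.1.2, inner_neg_right, inner_neg_right] at h4
    rw [real_inner_smul_left, inner_sub_left, real_inner_smul_left, inner_ξ_left]
    linarith
  · rintro ⟨h1, hF⟩
    refine ⟨⟨comm_of_smul_proj h1, hF⟩, fun X Y ↦ ?_⟩
    have h2 : inner ℝ Y (a.φ X) = -inner ℝ X (a.φ Y) := by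
      rw [real_inner_comm, inner_φ_left]
    rw [extEta, h1, h1, real_inner_smul_left, real_inner_smul_left, inner_sub_left,
      inner_sub_left, real_inner_smul_left, real_inner_smul_left, inner_ξ_left, inner_ξ_left,
      a.η_φ, a.η_φ, h2, Phi]
    ring

end Represents

end Pointwise

end LinearStructure

end

end ACM

/-! ### From the Levi-Civita connection to the pointwise data -/

namespace ACM

noncomputable section

section Manifold

variable {E : Type*} [NormedAddCommGroup E] [NormedSpace ℝ E] [FiniteDimensional ℝ E]
  {H : Type*} [TopologicalSpace H] {I : ModelWithCorners ℝ E H}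
  {M : Type*} [TopologicalSpace M] [ChartedSpace H M] [IsManifold I ∞ M]
  [RiemannianBundle (fun x : M ↦ TangentSpace I x)]
  [IsContMDiffRiemannianBundle I ∞ E (fun x : M ↦ TangentSpace I x)]

theorem mlieBracket_eq {x : M} {X Y : Π x : M, TangentSpace I x}
    (hX : MDiffAt (T% X) x) (hY : MDiffAt (T% Y) x) :
    mlieBracket I X Y x = leviCivita Y x (X x) - leviCivita X x (Y x) :=
  ((CovariantDerivative.torsion_eq_zero_iff _).1 leviCivita_torsion hX hY).symm

namespace AlmostContactMetricStructure

variable (s : AlmostContactMetricStructure I M)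

theorem inner_φ_left (x : M) (X Y : TangentSpace I x) :
    inner ℝ (s.φ x X) Y = -inner ℝ X (s.φ x Y) := (s.linAt x).inner_φ_left X Y

theorem inner_φ_right {x : M} (X Y : TangentSpace I x) :
    inner ℝ X (s.φ x Y) = -inner ℝ Y (s.φ x X) := by
  rw [← inner_φ_left, real_inner_comm]

theorem inner_ξ_left (x : M) (X : TangentSpace I x) : inner ℝ (s.ξ x) X = s.η x X :=
  (s.linAt x).inner_ξ_left X

theorem φ_ξ (x : M) : s.φ x (s.ξ x) = 0 := (s.linAt x).φ_ξ

theorem η_φ (x : M) (X : TangentSpace I x) : s.η x (s.φ x X) = 0 := (s.linAt x).η_φ X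

/-- `(∇_u φ) Z = ∇_u (φ Z) - φ (∇_u Z)`. -/
def nablaφ (Z : Π x : M, TangentSpace I x) (x : M) (u : TangentSpace I x) : TangentSpace I x :=
  leviCivita (s.φField Z) x u - s.φ x (leviCivita Z x u)

/-- Metric compatibility turns the derivative of `g(Y, φZ)` into covariant derivatives, leaving only
that of `φ`. -/
theorem nablaPhiAux_eq_inner {x : M} {X Y Z : Π x : M, TangentSpace I x}
    (hX : MDiffAt (T% X) x) (hY : MDiffAt (T% Y) x) (hZ : MDiffAt (T% Z) x) :
    s.nablaPhiAux Y Z x (X x) = inner ℝ (Y x) (s.nablaφ Z x (X x)) := by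
  rw [nablaPhiAux_apply, nablaφ, inner_sub_right]
  change d% (fun y ↦ inner ℝ (Y y) (s.φField Z y)) x (X x) - _ - _ = _
  rw [leviCivita_metric hX hY (s.mdifferentiableAt_φField hZ)]
  simp only [φField]
  ring

theorem nablaPhi_eq_aux {x : M} {Y Z : Π x : M, TangentSpace I x}
    (hY : MDiffAt (T% Y) x) (hZ : MDiffAt (T% Z) x) (u : TangentSpace I x) :
    s.nablaPhi x u (Y x) (Z x) = s.nablaPhiAux Y Z x u :=
  DFunLike.congr_fun (TensorialAt.mkHom₂_apply (fun _ hZ ↦ s.nablaPhiAux_tensorial_left hZ)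
    (fun _ hY ↦ s.nablaPhiAux_tensorial_right hY) hY hZ) u

theorem nablaPhi_eq {x : M} {X Y Z : Π x : M, TangentSpace I x}
    (hX : MDiffAt (T% X) x) (hY : MDiffAt (T% Y) x) (hZ : MDiffAt (T% Z) x) :
    s.nablaPhi x (X x) (Y x) (Z x) = inner ℝ (Y x) (s.nablaφ Z x (X x)) := by
  rw [s.nablaPhi_eq_aux hY hZ, s.nablaPhiAux_eq_inner hX hY hZ]

theorem mdifferentiableAt_η {x : M} {X : Π x : M, TangentSpace I x} (hX : MDiffAt (T% X) x) :
    MDiffAt (fun y ↦ s.η y (X y)) x := by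
  simp_rw [← inner_ξ_left]
  exact mdifferentiableAt_inner (s.mdifferentiableAt_ξ x) hX

/-- Differentiate `g(ξ,ξ) = 1`. -/
theorem η_nabla_ξ (x : M) (u : TangentSpace I x) : s.η x (leviCivita s.ξ x u) = 0 := by
  have hX := FiberBundle.mdifferentiableAt_extend I E u
  have h := leviCivita_metric hX (s.mdifferentiableAt_ξ x) (s.mdifferentiableAt_ξ x)
  simp only [s.inner_ξ_left, s.η_ξ, real_inner_comm (s.ξ _), FiberBundle.extend_apply_self] at h
  rw [mvfderiv_const, zero_apply] at h
  linarith

theorem S_apply (x : M) (u : TangentSpace I x) :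
    s.S x u = s.φ x (leviCivita s.ξ x u) := rfl

theorem φ_S (x : M) (u : TangentSpace I x) : s.φ x (s.S x u) = -leviCivita s.ξ x u := by
  rw [S_apply, s.φ_sq, s.η_nabla_ξ, zero_smul, add_zero]

theorem nablaφ_ξ (x : M) (u : TangentSpace I x) : s.nablaφ s.ξ x u = -s.S x u := by
  have h : s.φField s.ξ = 0 := by
    funext y
    exact s.φ_ξ y
  rw [nablaφ, h, leviCivita.isCovariantDerivativeOn.zero (s := Set.univ) (Set.mem_univ x),
    zero_apply, zero_sub]
  rfl

/-- This is the derivative of `φ² = -I + η ⊗ ξ`. The coefficient of `ξ` may stay unspecified: it is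
only ever paired with vectors `φY`, which are orthogonal to `ξ`. -/
theorem nablaφ_φ {x : M} {Z : Π x : M, TangentSpace I x} (hZ : MDiffAt (T% Z) x)
    (u : TangentSpace I x) : ∃ c : ℝ, s.nablaφ (s.φField Z) x u =
      -s.φ x (s.nablaφ Z x u) + s.η x (Z x) • leviCivita s.ξ x u + c • s.ξ x := by
  have h : s.φField (s.φField Z) = (-1 : ℝ) • Z + (fun y ↦ s.η y (Z y)) • s.ξ := by
    funext y
    simp [φField, s.φ_sq]
  have hη := s.mdifferentiableAt_η hZ
  refine ⟨d% (fun y ↦ s.η y (Z y)) x u - s.η x (leviCivita Z x u), ?_⟩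
  have h1 : leviCivita (s.φField (s.φField Z)) x u = -leviCivita Z x u +
      (s.η x (Z x) • leviCivita s.ξ x u + d% (fun y ↦ s.η y (Z y)) x u • s.ξ x) := by
    have hZ' : MDiffAt (T% ((-1 : ℝ) • Z)) x :=
      (mdifferentiableAt_const (c := (-1 : ℝ))).smul_section hZ
    have hξ := s.mdifferentiableAt_ξ x
    rw [h, leviCivita.isCovariantDerivativeOn.add (s := Set.univ) hZ' (hη.smul_section hξ),
      leviCivita.isCovariantDerivativeOn.smul_const (s := Set.univ) (-1) hZ,
      leviCivita.isCovariantDerivativeOn.leibniz (s := Set.univ) hξ hη]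
    simp
  rw [nablaφ, nablaφ, h1, map_sub, s.φ_sq, sub_smul]
  abel

/-- The first symmetry is skewness of `Φ`; the second is `nablaφ_φ` paired with `φY`. -/
theorem nablaPhi_mem_CV (x : M) : s.nablaPhi x ∈ (s.linAt x).CV := by
  intro u v w
  have hX := FiberBundle.mdifferentiableAt_extend I E u
  have hY := FiberBundle.mdifferentiableAt_extend I E v
  have hZ := FiberBundle.mdifferentiableAt_extend I E w
  have hξ := s.mdifferentiableAt_ξ x
  set X : Π x : M, TangentSpace I x := FiberBundle.extend E u
  set Y : Π x : M, TangentSpace I x := FiberBundle.extend E v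
  set Z : Π x : M, TangentSpace I x := FiberBundle.extend E w
  have eX : X x = u := FiberBundle.extend_apply_self ..
  have eY : Y x = v := FiberBundle.extend_apply_self ..
  have eZ : Z x = w := FiberBundle.extend_apply_self ..
  rw [← eX, ← eY, ← eZ]
  constructor
  · have h1 : s.PhiField Y Z = -s.PhiField Z Y := by
      funext y
      simp only [PhiField, Pi.neg_apply]
      rw [real_inner_comm, inner_φ_left]
    rw [s.nablaPhi_eq_aux hY hZ, s.nablaPhi_eq_aux hZ hY, nablaPhiAux_apply, nablaPhiAux_apply, h1,
      mvfderiv_neg, neg_apply, s.inner_φ_right (Y x), s.inner_φ_right (Z x)]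
    ring
  · change _ = -s.nablaPhi x (X x) (s.φField Y x) (s.φField Z x) +
      s.η x (Y x) * s.nablaPhi x (X x) (s.ξ x) (Z x) +
      s.η x (Z x) * s.nablaPhi x (X x) (Y x) (s.ξ x)
    obtain ⟨c, hc⟩ := s.nablaφ_φ hZ (X x)
    rw [s.nablaPhi_eq hX hY hZ, s.nablaPhi_eq hX (s.mdifferentiableAt_φField hY)
      (s.mdifferentiableAt_φField hZ), s.nablaPhi_eq hX hξ hZ, s.nablaPhi_eq hX hY hξ, hc,
      nablaφ_ξ]
    have h1 : inner ℝ (s.φField Y x) (s.ξ x) = 0 := by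
      rw [real_inner_comm, s.inner_ξ_left]
      exact s.η_φ _ _
    have h2 : inner ℝ (s.φField Y x) (leviCivita s.ξ x (X x)) = -inner ℝ (Y x) (s.S x (X x)) :=
      s.inner_φ_left _ _ _
    have h3 (v) : inner ℝ (s.φField Y x) (s.φ x v) =
        inner ℝ (Y x) v - s.η x (Y x) * s.η x v := s.inner_φ _ _ _
    simp only [inner_add_right, inner_neg_right, real_inner_smul_right, h1, h2, h3,
      s.inner_ξ_left]
    ring

theorem nablaPhi_ξ (x : M) (u w : TangentSpace I x) :
    s.nablaPhi x u (s.ξ x) w = inner ℝ (s.S x u) w := by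
  have hX := FiberBundle.mdifferentiableAt_extend I E u
  have hZ := FiberBundle.mdifferentiableAt_extend I E w
  have h := s.nablaPhi_eq hX hZ (s.mdifferentiableAt_ξ x)
  rw [(s.linAt x).CV_skew (s.nablaPhi_mem_CV x)]
  simp only [FiberBundle.extend_apply_self] at h
  rw [h, nablaφ_ξ, inner_neg_right, neg_neg, real_inner_comm]

/-- `∇_ξ φ = 2h - φSφ - S`. -/
def nablaξφ (x : M) : TangentSpace I x →L[ℝ] TangentSpace I x :=
  (2 : ℝ) • s.h x - s.φ x ∘L s.S x ∘L s.φ x - s.S x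

/-- Torsion-freeness gives `(ℒ_ξ φ)Z = (∇_ξ φ)Z - ∇_{φZ}ξ + φ∇_Z ξ`, and substituting `∇ξ = -φS`
turns the last two terms into `φSφZ + SZ`. -/
theorem nablaξφ_eq {x : M} {Z : Π x : M, TangentSpace I x} (hZ : MDiffAt (T% Z) x) :
    s.nablaξφ x (Z x) = s.nablaφ Z x (s.ξ x) := by
  have h1 : s.lieφ x (Z x) = _ := TensorialAt.mkHom_apply (s.lieφ_tensorial x) hZ
  have hξ := s.mdifferentiableAt_ξ x
  have h2 : (2 : ℝ) • s.h x = s.lieφ x := by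
    rw [h, smul_smul]
    norm_num
  rw [nablaξφ, h2]
  simp only [sub_apply, ContinuousLinearMap.comp_apply]
  rw [h1, mlieBracket_eq hξ (s.mdifferentiableAt_φField hZ), mlieBracket_eq hξ hZ, map_sub, φ_S,
    nablaφ, ← S_apply]
  simp only [φField]
  abel

/-- The bridge by which every pointwise criterion applies to the manifold. -/
theorem represents (x : M) : (s.linAt x).Represents (s.nablaPhi x) (s.S x).toLinearMap
    (s.nablaξφ x).toLinearMap (s.h x).toLinearMap where
  mem_CV := s.nablaPhi_mem_CV x
  apply_ξ := s.nablaPhi_ξ x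
  ξ_apply u v := by
    have hX := FiberBundle.mdifferentiableAt_extend I E u
    have hY := FiberBundle.mdifferentiableAt_extend I E v
    have h := s.nablaPhi_eq (s.mdifferentiableAt_ξ x) hY hX
    rw [← s.nablaξφ_eq hX] at h
    simp only [FiberBundle.extend_apply_self] at h
    exact h
  two_h u := by
    change _ = s.nablaξφ x u + s.φ x (s.S x (s.φ x u)) + s.S x u
    change (2 : ℝ) • s.h x u = ((2 : ℝ) • s.h x u - _ - _) + _ + _
    rw [sub_sub, add_assoc]
    exact (sub_add_cancel _ _).symm

/-- Writing `η = g(ξ,·)`, the connection gives `⟨∇_X ξ,Y⟩ - ⟨∇_Y ξ,X⟩`, and `∇ξ = -φS`. -/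
theorem dEta_eq {x : M} {X Y : Π x : M, TangentSpace I x}
    (hX : MDiffAt (T% X) x) (hY : MDiffAt (T% Y) x) :
    s.dEta X Y x = (s.linAt x).extEta (s.S x).toLinearMap (X x) (Y x) := by
  have hξ := s.mdifferentiableAt_ξ x
  have h1 := leviCivita_metric hX hξ hY
  have h2 := leviCivita_metric hY hξ hX
  simp only [inner_ξ_left] at h1 h2
  change _ = inner ℝ (s.S x (X x)) (s.φ x (Y x)) - inner ℝ (s.S x (Y x)) (s.φ x (X x))
  rw [dEta, h1, h2, mlieBracket_eq hX hY, map_sub, ← neg_neg (inner ℝ (s.S x (X x)) _),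
    ← neg_neg (inner ℝ (s.S x (Y x)) _), ← inner_φ_left, ← inner_φ_left, φ_S, φ_S,
    inner_neg_left, inner_neg_left]
  ring

theorem dPhi_eq {x : M} {X Y Z : Π x : M, TangentSpace I x}
    (hX : MDiffAt (T% X) x) (hY : MDiffAt (T% Y) x) (hZ : MDiffAt (T% Z) x) :
    s.dPhi X Y Z x = LinearStructure.extPhi (s.nablaPhi x) (X x) (Y x) (Z x) := by
  rw [LinearStructure.extPhi, s.nablaPhi_eq_aux hY hZ, s.nablaPhi_eq_aux hZ hX,
    s.nablaPhi_eq_aux hX hY, nablaPhiAux_apply, nablaPhiAux_apply, nablaPhiAux_apply, dPhi]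
  simp only [PhiField]
  rw [mlieBracket_eq hX hY, mlieBracket_eq hY hZ, mlieBracket_eq hZ hX]
  simp only [inner_sub_left]
  rw [s.inner_φ_right (Y x), s.inner_φ_right (X x), s.inner_φ_right (Z x)]
  ring

/-- Without torsion the brackets combine to `(∇_{φX}φ)Y - (∇_{φY}φ)X - φ(∇_X φ)Y + φ(∇_Y φ)X`;
skewness of `φ` moves the outer `φ` onto `W`. -/
theorem inner_nijenhuis {x : M} {X Y W : Π x : M, TangentSpace I x}
    (hX : MDiffAt (T% X) x) (hY : MDiffAt (T% Y) x) (hW : MDiffAt (T% W) x) :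
    inner ℝ (W x) (s.nijenhuis X Y x) =
      (s.linAt x).nij (s.nablaPhi x) (s.S x).toLinearMap (X x) (Y x) (W x) := by
  have hφX := s.mdifferentiableAt_φField hX
  have hφY := s.mdifferentiableAt_φField hY
  have hφW := s.mdifferentiableAt_φField hW
  change _ = s.nablaPhi x (s.φField X x) (W x) (Y x) - s.nablaPhi x (s.φField Y x) (W x) (X x)
    + s.nablaPhi x (X x) (s.φField W x) (Y x) - s.nablaPhi x (Y x) (s.φField W x) (X x)
    + (s.linAt x).extEta (s.S x).toLinearMap (X x) (Y x) * s.η x (W x)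
  rw [s.nablaPhi_eq hφX hW hY, s.nablaPhi_eq hφY hW hX, s.nablaPhi_eq hX hφW hY,
    s.nablaPhi_eq hY hφW hX, ← s.dEta_eq hX hY, nijenhuis, mlieBracket_eq hφX hφY,
    mlieBracket_eq hX hY, mlieBracket_eq hX hφY, mlieBracket_eq hφX hY]
  have h1 : inner ℝ (W x) (s.ξ x) = s.η x (W x) := by rw [real_inner_comm, inner_ξ_left]
  simp only [inner_add_right, inner_sub_right, map_sub, real_inner_smul_right, h1, nablaφ,
    s.inner_φ_left, φField]
  ring

/-! ### Conditions on vector fields as pointwise conditions -/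

theorem isNormal_iff : s.IsNormal ↔ ∀ x, ∀ X Y W,
    (s.linAt x).nij (s.nablaPhi x) (s.S x).toLinearMap X Y W = 0 := by
  constructor
  · intro h x X Y W
    have := s.inner_nijenhuis (FiberBundle.mdifferentiableAt_extend I E X)
      (FiberBundle.mdifferentiableAt_extend I E Y) (FiberBundle.mdifferentiableAt_extend I E W)
    rw [h x _ _ (FiberBundle.contMDiffAt_extend I E X) (FiberBundle.contMDiffAt_extend I E Y),
      inner_zero_right] at this
    simpa only [FiberBundle.extend_apply_self] using this.symm
  · intro h x X Y hX hY
    refine ext_inner_left ℝ fun W ↦ ?_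
    have := s.inner_nijenhuis (hX.mdifferentiableAt (by simp)) (hY.mdifferentiableAt (by simp))
      (FiberBundle.mdifferentiableAt_extend I E W)
    rw [h, FiberBundle.extend_apply_self] at this
    rw [this, inner_zero_right]

theorem dEtaEq_iff (f : M → ℝ) : s.DEtaEq f ↔ ∀ x, ∀ X Y,
    (s.linAt x).extEta (s.S x).toLinearMap X Y = 2 * f x * (s.linAt x).Phi X Y := by
  constructor
  · intro h x X Y
    have := h x _ _ (FiberBundle.contMDiffAt_extend I E X) (FiberBundle.contMDiffAt_extend I E Y)
    rw [s.dEta_eq (FiberBundle.mdifferentiableAt_extend I E X)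
      (FiberBundle.mdifferentiableAt_extend I E Y)] at this
    simp only [PhiField, FiberBundle.extend_apply_self] at this
    exact this
  · intro h x X Y hX hY
    rw [s.dEta_eq (hX.mdifferentiableAt (by simp)) (hY.mdifferentiableAt (by simp)), h]
    rfl

theorem dPhiEq_iff (f : M → ℝ) : s.DPhiEq f ↔ ∀ x, ∀ X Y Z,
    LinearStructure.extPhi (s.nablaPhi x) X Y Z = 2 * f x * ((s.linAt x).η X *
      (s.linAt x).Phi Y Z + (s.linAt x).η Y * (s.linAt x).Phi Z X +
      (s.linAt x).η Z * (s.linAt x).Phi X Y) := by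
  constructor
  · intro h x X Y Z
    have := h x _ _ _ (FiberBundle.contMDiffAt_extend I E X)
      (FiberBundle.contMDiffAt_extend I E Y) (FiberBundle.contMDiffAt_extend I E Z)
    rw [s.dPhi_eq (FiberBundle.mdifferentiableAt_extend I E X)
      (FiberBundle.mdifferentiableAt_extend I E Y)
      (FiberBundle.mdifferentiableAt_extend I E Z)] at this
    simp only [PhiField, FiberBundle.extend_apply_self] at this
    exact this
  · intro h x X Y Z hX hY hZ
    rw [s.dPhi_eq (hX.mdifferentiableAt (by simp)) (hY.mdifferentiableAt (by simp))
      (hZ.mdifferentiableAt (by simp)), h]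
    rfl

end AlmostContactMetricStructure

end Manifold

end

end ACM

/-! ### The classes of a manifold at a point -/

namespace ACM

section Manifold

variable {E : Type*} [NormedAddCommGroup E] [NormedSpace ℝ E] [FiniteDimensional ℝ E]
  {H : Type*} [TopologicalSpace H] {I : ModelWithCorners ℝ E H}
  {M : Type*} [TopologicalSpace M] [ChartedSpace H M] [IsManifold I ∞ M]
  [RiemannianBundle (fun x : M ↦ TangentSpace I x)]
  [IsContMDiffRiemannianBundle I ∞ E (fun x : M ↦ TangentSpace I x)]

namespace AlmostContactMetricStructure

variable (s : AlmostContactMetricStructure I M)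

/-- By its definition `P` is `-∇_ξ φ`. -/
theorem P_eq_zero_iff (x : M) : s.P x = 0 ↔ ∀ X, s.nablaξφ x X = 0 := by
  have h : s.P x = -s.nablaξφ x := by
    rw [P, nablaξφ]
    module
  rw [h, neg_eq_zero, ContinuousLinearMap.ext_iff]
  rfl

theorem two_h_eq_iff (x : M) : (2 : ℝ) • s.h x = s.S x + s.φ x ∘L s.S x ∘L s.φ x ↔
    ∀ X, s.nablaξφ x X = 0 := by
  have h : s.nablaξφ x = (2 : ℝ) • s.h x - (s.S x + s.φ x ∘L s.S x ∘L s.φ x) := by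
    rw [nablaξφ]
    module
  rw [← sub_eq_zero, ← h, ContinuousLinearMap.ext_iff]
  rfl

variable {s} in
theorem IsHParallel.isHZero (hp : s.IsHParallel) (x : M) :
    (s.linAt x).IsHZero (s.nablaPhi x) := hp x

variable {s} {x : M}

theorem S_mem_EndComm_one_iff (hH : (s.S x).toLinearMap ∈ (s.linAt x).EndH) :
    (s.S x).toLinearMap ∈ (s.linAt x).EndComm 1 ↔ s.S x ∘L s.φ x = s.φ x ∘L s.S x := by
  rw [LinearStructure.mem_EndComm, and_iff_right hH, ContinuousLinearMap.ext_iff]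
  exact forall_congr' fun X ↦ by rw [one_smul]; rfl

theorem S_mem_EndComm_neg_one_iff (hH : (s.S x).toLinearMap ∈ (s.linAt x).EndH) :
    (s.S x).toLinearMap ∈ (s.linAt x).EndComm (-1) ↔ s.S x ∘L s.φ x = -(s.φ x ∘L s.S x) := by
  rw [LinearStructure.mem_EndComm, and_iff_right hH, ContinuousLinearMap.ext_iff]
  exact forall_congr' fun X ↦ by rw [neg_smul, one_smul]; rfl

theorem h_eq_zero_iff : s.h x = 0 ↔ ∀ X, (s.h x).toLinearMap X = 0 := ContinuousLinearMap.ext_iff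

theorem S_eq_zero_iff : s.S x = 0 ↔ ∀ X, (s.S x).toLinearMap X = 0 := ContinuousLinearMap.ext_iff

theorem h_eq_S_iff : s.h x = s.S x ↔ ∀ X, (s.h x).toLinearMap X = (s.S x).toLinearMap X :=
  ContinuousLinearMap.ext_iff

/-! ### Pointwise form of the classes -/

section Classes

variable {n : ℕ} (hn : Module.finrank ℝ (TangentSpace I x) = 2 * n + 1)
  (hz : (s.linAt x).IsHZero (s.nablaPhi x))

include hn hz

theorem mem_C5to10_iff : s.nablaPhi x ∈ (s.linAt x).C5to10 n ↔
    s.S x (s.ξ x) = 0 ∧ ∀ X, s.nablaξφ x X = 0 := by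
  rw [(s.linAt x).C5to10_eq hn, (s.represents x).mem_map_iff_F hz le_rfl]
  exact and_congr_left fun _ ↦ ⟨fun h ↦ h.1, (s.represents x).mem_EndH⟩

theorem mem_C5to8_iff : s.nablaPhi x ∈ (s.linAt x).C5to8 n ↔
    (s.S x).toLinearMap ∈ (s.linAt x).EndComm 1 ∧ ∀ X, s.nablaξφ x X = 0 := by
  rw [(s.linAt x).C5to8_eq hn, (s.represents x).mem_map_iff_F hz ((s.linAt x).EndComm_le_EndH _)]
  rfl

theorem mem_C5_sup_C8_iff : s.nablaPhi x ∈ (s.linAt x).C5 n ⊔ (s.linAt x).C8 ↔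
    ((s.S x).toLinearMap ∈ (s.linAt x).EndSym (-1) ∧
      (s.S x).toLinearMap ∈ (s.linAt x).EndComm 1) ∧ ∀ X, s.nablaξφ x X = 0 := by
  rw [(s.linAt x).C5_sup_C8 hn, (s.represents x).mem_map_iff_F hz
    (inf_le_left.trans ((s.linAt x).EndSym_le_EndH _))]
  rfl

theorem mem_C6_sup_C7_iff : s.nablaPhi x ∈ (s.linAt x).C6 n ⊔ (s.linAt x).C7 ↔
    ((s.S x).toLinearMap ∈ (s.linAt x).EndSym 1 ∧
      (s.S x).toLinearMap ∈ (s.linAt x).EndComm 1) ∧ ∀ X, s.nablaξφ x X = 0 := by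
  rw [(s.linAt x).C6_sup_C7 hn, (s.represents x).mem_map_iff_F hz
    (inf_le_left.trans ((s.linAt x).EndSym_le_EndH _))]
  rfl

theorem mem_C5_iff : s.nablaPhi x ∈ (s.linAt x).C5 n ↔
    s.S x = (-(1 / (2 * n : ℝ)) * tr (s.φ x ∘L s.S x)) • s.φ x ∧ ∀ X, s.nablaξφ x X = 0 := by
  rw [(s.represents x).mem_C5_iff_F hn hz, LinearStructure.Represents.exists_smul_φ_iff hn,
    ContinuousLinearMap.ext_iff]
  rfl

theorem mem_C6_iff : s.nablaPhi x ∈ (s.linAt x).C6 n ↔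
    (∀ X, s.S x X = (1 / (2 * n : ℝ) * tr (s.S x)) • (X - s.η x X • s.ξ x)) ∧
      ∀ X, s.nablaξφ x X = 0 := by
  rw [(s.represents x).mem_C6_iff_F hn hz, LinearStructure.Represents.exists_smul_proj_iff hn]
  rfl

omit hn

theorem mem_C9_sup_C10_iff : s.nablaPhi x ∈ (s.linAt x).C9 ⊔ (s.linAt x).C10 ↔
    (s.S x).toLinearMap ∈ (s.linAt x).EndComm (-1) ∧ ∀ X, s.nablaξφ x X = 0 := by
  rw [(s.linAt x).C9_sup_C10, (s.represents x).mem_map_iff_F hz ((s.linAt x).EndComm_le_EndH _)]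
  rfl

theorem mem_C7_iff : s.nablaPhi x ∈ (s.linAt x).C7 ↔
    (((s.S x).toLinearMap ∈ (s.linAt x).EndSym 1 ∧
      (s.S x).toLinearMap ∈ (s.linAt x).EndComm 1) ∧ tr (s.S x) = 0) ∧
      ∀ X, s.nablaξφ x X = 0 := by
  rw [(s.linAt x).C7_eq, (s.represents x).mem_map_iff_F hz
    ((inf_le_left.trans inf_le_left).trans ((s.linAt x).EndSym_le_EndH _))]
  rfl

theorem mem_C8_iff : s.nablaPhi x ∈ (s.linAt x).C8 ↔
    (((s.S x).toLinearMap ∈ (s.linAt x).EndSym (-1) ∧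
      (s.S x).toLinearMap ∈ (s.linAt x).EndComm 1) ∧ tr (s.φ x ∘L s.S x) = 0) ∧
      ∀ X, s.nablaξφ x X = 0 := by
  rw [(s.linAt x).C8_eq, (s.represents x).mem_map_iff_F hz
    ((inf_le_left.trans inf_le_left).trans ((s.linAt x).EndSym_le_EndH _))]
  rfl

theorem mem_C9_iff : s.nablaPhi x ∈ (s.linAt x).C9 ↔
    ((s.S x).toLinearMap ∈ (s.linAt x).EndSym 1 ∧
      (s.S x).toLinearMap ∈ (s.linAt x).EndComm (-1)) ∧ ∀ X, s.nablaξφ x X = 0 := by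
  rw [(s.linAt x).C9_eq, (s.represents x).mem_map_iff_F hz
    (inf_le_left.trans ((s.linAt x).EndSym_le_EndH _))]
  rfl

theorem mem_C10_iff : s.nablaPhi x ∈ (s.linAt x).C10 ↔
    ((s.S x).toLinearMap ∈ (s.linAt x).EndSym (-1) ∧
      (s.S x).toLinearMap ∈ (s.linAt x).EndComm (-1)) ∧ ∀ X, s.nablaξφ x X = 0 := by
  rw [(s.linAt x).C10_eq, (s.represents x).mem_map_iff_F hz
    (inf_le_left.trans ((s.linAt x).EndSym_le_EndH _))]
  rfl

end Classes

theorem isSymm_iff : (s.linAt x).IsSymmOnH (s.S x) ↔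
    (s.S x).toLinearMap ∈ (s.linAt x).EndSym 1 :=
  LinearStructure.Represents.mem_EndSym_iff_isSymmOnH.symm

theorem isSkew_iff : (s.linAt x).IsSkewOnH (s.S x) ↔
    (s.S x).toLinearMap ∈ (s.linAt x).EndSym (-1) :=
  LinearStructure.Represents.mem_EndSym_iff_isSkewOnH.symm

theorem φ_h_eq_zero_iff : s.φ x ∘L s.h x = 0 ↔
    ∀ X, (s.linAt x).φ ((s.h x).toLinearMap X) = 0 := ContinuousLinearMap.ext_iff

end AlmostContactMetricStructure

end Manifold

end ACM

/-! ### Assembly of the classification -/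

open ACM AlmostContactMetricStructure in
theorem theorem3p1
    {E : Type*} [NormedAddCommGroup E] [NormedSpace ℝ E] [FiniteDimensional ℝ E]
    {H : Type*} [TopologicalSpace H] {I : ModelWithCorners ℝ E H}
    {M : Type*} [TopologicalSpace M] [ChartedSpace H M] [IsManifold I ∞ M]
    [BoundarylessManifold I M]
    [RiemannianBundle (fun x : M ↦ TangentSpace I x)]
    [IsContMDiffRiemannianBundle I ∞ E (fun x : M ↦ TangentSpace I x)]
    (n : ℕ) (hdim : Module.finrank ℝ E = 2 * n + 1)
    (s : ACM.AlmostContactMetricStructure I M) :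
    -- the classes are mutually orthogonal
    (∀ x, ∀ i j : Fin 8, i ≠ j →
      ∀ α ∈ (![(s.linAt x).C5 n, (s.linAt x).C6 n, (s.linAt x).C7, (s.linAt x).C8,
          (s.linAt x).C9, (s.linAt x).C10, (s.linAt x).C11, (s.linAt x).C12] :
          Fin 8 → Submodule ℝ (ACM.Tensor3 (TangentSpace I x))) i,
      ∀ β ∈ (![(s.linAt x).C5 n, (s.linAt x).C6 n, (s.linAt x).C7, (s.linAt x).C8,
          (s.linAt x).C9, (s.linAt x).C10, (s.linAt x).C11, (s.linAt x).C12] :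
          Fin 8 → Submodule ℝ (ACM.Tensor3 (TangentSpace I x))) j,
        ACM.tensorInner α β = 0) ∧
    -- `ℋ`-parallel manifolds are those of class `𝒟₂ ⊕ 𝒟₃`
    (s.IsHParallel ↔ s.IsOfClass fun x ↦ (s.linAt x).D2 n ⊔ (s.linAt x).D3) ∧
    (s.IsHParallel →
      -- first step of the flowchart
      ((s.IsOfClass fun x ↦ (s.linAt x).D3) ↔
        ∀ x, (∀ X, s.η x X = 0 → s.S x X = 0) ∧ s.φ x ∘L s.h x = 0) ∧
      ((s.IsOfClass fun x ↦ (s.linAt x).D2 n) ↔ ∀ x, s.S x (s.ξ x) = 0) ∧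
      -- inside `𝒟₂`
      ((s.IsOfClass fun x ↦ (s.linAt x).D2 n) →
        ((s.IsOfClass fun x ↦ (s.linAt x).C11) ↔ ∀ x, s.S x = 0) ∧
        ((s.IsOfClass fun x ↦ (s.linAt x).C5to10 n) ↔ ∀ x, s.P x = 0) ∧
        ((s.IsOfClass fun x ↦ (s.linAt x).C5to10 n) ↔
          ∀ x, (2 : ℝ) • s.h x = s.S x + s.φ x ∘L s.S x ∘L s.φ x)) ∧
      -- inside `𝒞₅ ⊕ ⋯ ⊕ 𝒞₁₀`
      ((s.IsOfClass fun x ↦ (s.linAt x).C5to10 n) →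
        ((s.IsOfClass fun x ↦ (s.linAt x).C9 ⊔ (s.linAt x).C10) ↔
          ∀ x, s.S x ∘L s.φ x + s.φ x ∘L s.S x = 0) ∧
        ((s.IsOfClass fun x ↦ (s.linAt x).C9 ⊔ (s.linAt x).C10) ↔ ∀ x, s.h x = s.S x) ∧
        ((s.IsOfClass fun x ↦ (s.linAt x).C5to8 n) ↔
          ∀ x, s.S x ∘L s.φ x - s.φ x ∘L s.S x = 0) ∧
        ((s.IsOfClass fun x ↦ (s.linAt x).C5to8 n) ↔ ∀ x, s.h x = 0)) ∧
      -- inside `𝒞₉ ⊕ 𝒞₁₀`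
      ((s.IsOfClass fun x ↦ (s.linAt x).C9 ⊔ (s.linAt x).C10) →
        ((s.IsOfClass fun x ↦ (s.linAt x).C10) ↔ ∀ x, (s.linAt x).IsSkewOnH (s.S x)) ∧
        ((s.IsOfClass fun x ↦ (s.linAt x).C9) ↔ ∀ x, (s.linAt x).IsSymmOnH (s.S x))) ∧
      -- inside `𝒞₅ ⊕ ⋯ ⊕ 𝒞₈`
      ((s.IsOfClass fun x ↦ (s.linAt x).C5to8 n) →
        ((s.IsOfClass fun x ↦ (s.linAt x).C5 n ⊔ (s.linAt x).C8) ↔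
          ∀ x, (s.linAt x).IsSkewOnH (s.S x)) ∧
        ((s.IsOfClass fun x ↦ (s.linAt x).C6 n ⊔ (s.linAt x).C7) ↔
          ∀ x, (s.linAt x).IsSymmOnH (s.S x))) ∧
      -- inside `𝒞₅ ⊕ 𝒞₈`
      ((s.IsOfClass fun x ↦ (s.linAt x).C5 n ⊔ (s.linAt x).C8) →
        ((s.IsOfClass fun x ↦ (s.linAt x).C8) ↔ ∀ x, ACM.tr (s.φ x ∘L s.S x) = 0) ∧
        ((s.IsOfClass fun x ↦ (s.linAt x).C5 n) ↔
          ∀ x, s.S x = (-(1 / (2 * n : ℝ)) * ACM.tr (s.φ x ∘L s.S x)) • s.φ x)) ∧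
      -- inside `𝒞₆ ⊕ 𝒞₇`
      ((s.IsOfClass fun x ↦ (s.linAt x).C6 n ⊔ (s.linAt x).C7) →
        ((s.IsOfClass fun x ↦ (s.linAt x).C6 n) ↔
          ∀ x X, s.S x X = (1 / (2 * n : ℝ) * ACM.tr (s.S x)) • (X - s.η x X • s.ξ x)) ∧
        ((s.IsOfClass fun x ↦ (s.linAt x).C7) ↔ ∀ x, ACM.tr (s.S x) = 0)) ∧
      -- the named classes
      ((s.IsOfClass fun x ↦ (s.linAt x).C5to8 n) ↔ s.IsNormal) ∧
      ((s.IsOfClass fun x ↦ (s.linAt x).C9) ↔ s.IsAlmostCokahler) ∧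
      ((s.IsOfClass fun x ↦ (s.linAt x).C6 n ⊔ (s.linAt x).C7) ↔ s.IsQuasiSasakian) ∧
      ((s.IsOfClass fun x ↦ (s.linAt x).C5 n) ↔ s.IsBetaKenmotsu) ∧
      ((s.IsOfClass fun x ↦ (s.linAt x).C6 n) ↔ s.IsAlphaSasakian) ∧
      -- the irreducible classes among all `ℋ`-parallel manifolds
      ((s.IsOfClass fun x ↦ (s.linAt x).C5 n) ↔ ∀ x, s.h x = 0 ∧
        s.S x = (-(1 / (2 * n : ℝ)) * ACM.tr (s.φ x ∘L s.S x)) • s.φ x) ∧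
      ((s.IsOfClass fun x ↦ (s.linAt x).C6 n) ↔ ∀ x, s.h x = 0 ∧
        ∀ X, s.S x X = (1 / (2 * n : ℝ) * (s.linAt x).deltaPhi (s.nablaPhi x) (s.ξ x)) •
          (X - s.η x X • s.ξ x)) ∧
      ((s.IsOfClass fun x ↦ (s.linAt x).C7) ↔ ∀ x, s.h x = 0 ∧
        (s.linAt x).IsSymmOnH (s.S x) ∧ s.S x ∘L s.φ x = s.φ x ∘L s.S x ∧
        ACM.tr (s.S x) = 0) ∧
      ((s.IsOfClass fun x ↦ (s.linAt x).C8) ↔ ∀ x, s.h x = 0 ∧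
        (s.linAt x).IsSkewOnH (s.S x) ∧ s.S x ∘L s.φ x = s.φ x ∘L s.S x ∧
        ACM.tr (s.φ x ∘L s.S x) = 0) ∧
      ((s.IsOfClass fun x ↦ (s.linAt x).C9) ↔ ∀ x, s.h x = s.S x ∧
        (s.linAt x).IsSymmOnH (s.S x) ∧ s.S x ∘L s.φ x = -(s.φ x ∘L s.S x)) ∧
      ((s.IsOfClass fun x ↦ (s.linAt x).C10) ↔ ∀ x, s.h x = s.S x ∧
        (s.linAt x).IsSkewOnH (s.S x) ∧ s.S x ∘L s.φ x = -(s.φ x ∘L s.S x)) ∧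
      ((s.IsOfClass fun x ↦ (s.linAt x).C11) ↔ ∀ x, s.S x = 0) ∧
      ((s.IsOfClass fun x ↦ (s.linAt x).C12) ↔
        ∀ x, (∀ X, s.η x X = 0 → s.S x X = 0) ∧ s.φ x ∘L s.h x = 0)) := by
  have hn (x : M) : Module.finrank ℝ (TangentSpace I x) = 2 * n + 1 := hdim
  refine ⟨fun x i j hij α hα β hβ ↦ (s.linAt x).orthogonal_classes (hn x) hij hα hβ,
    forall_congr' fun x ↦ (s.represents x).isHZero_iff_mem (hn x), fun hp ↦ ?_⟩
  have hz := hp.isHZero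
  have r := s.represents
  have h12 : (s.IsOfClass fun x ↦ (s.linAt x).C12) ↔
      ∀ x, (∀ X, s.η x X = 0 → s.S x X = 0) ∧ s.φ x ∘L s.h x = 0 :=
    forall_congr' fun x ↦ by
      rw [(r x).mem_C12_iff (hz x), φ_h_eq_zero_iff]
      rfl
  have hD2 : (s.IsOfClass fun x ↦ (s.linAt x).D2 n) ↔ ∀ x, s.S x (s.ξ x) = 0 :=
    forall_congr' fun x ↦ (r x).mem_D2_iff (hn x) (hz x)
  have h11 : (s.IsOfClass fun x ↦ (s.linAt x).C11) ↔ ∀ x, s.S x = 0 :=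
    forall_congr' fun x ↦ by
      rw [(r x).mem_C11_iff (hz x), S_eq_zero_iff]
  refine ⟨h12, hD2, fun hU ↦ ⟨h11, ?_, ?_⟩, fun hU ↦ ⟨?_, ?_, ?_, ?_⟩, fun hU ↦ ⟨?_, ?_⟩,
    fun hU ↦ ⟨?_, ?_⟩, fun hU ↦ ⟨?_, ?_⟩, fun hU ↦ ⟨?_, ?_⟩, ?_, ?_, ?_, ?_, ?_, ?_, ?_, ?_, ?_,
    ?_, ?_, h11, h12⟩
  · refine forall_congr' fun x ↦ ?_
    rw [mem_C5to10_iff (hn x) (hz x), P_eq_zero_iff, and_iff_right (hD2.1 hU x)]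
  · refine forall_congr' fun x ↦ ?_
    rw [mem_C5to10_iff (hn x) (hz x), two_h_eq_iff, and_iff_right (hD2.1 hU x)]
  · refine forall_congr' fun x ↦ ?_
    obtain ⟨hξ, hF⟩ := (mem_C5to10_iff (hn x) (hz x)).1 (hU x)
    rw [mem_C9_sup_C10_iff (hz x), and_iff_left hF,
      S_mem_EndComm_neg_one_iff ((r x).mem_EndH hξ), add_eq_zero_iff_eq_neg]
  · refine forall_congr' fun x ↦ ?_
    obtain ⟨hξ, hF⟩ := (mem_C5to10_iff (hn x) (hz x)).1 (hU x)
    rw [mem_C9_sup_C10_iff (hz x), and_iff_left hF, (r x).anti_iff_h hξ hF, h_eq_S_iff]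
  · refine forall_congr' fun x ↦ ?_
    obtain ⟨hξ, hF⟩ := (mem_C5to10_iff (hn x) (hz x)).1 (hU x)
    rw [mem_C5to8_iff (hn x) (hz x), and_iff_left hF,
      S_mem_EndComm_one_iff ((r x).mem_EndH hξ), sub_eq_zero]
  · refine forall_congr' fun x ↦ ?_
    obtain ⟨hξ, hF⟩ := (mem_C5to10_iff (hn x) (hz x)).1 (hU x)
    rw [mem_C5to8_iff (hn x) (hz x), and_iff_left hF, (r x).comm_iff_h hξ hF, h_eq_zero_iff]
  · refine forall_congr' fun x ↦ ?_
    obtain ⟨hS, hF⟩ := (mem_C9_sup_C10_iff (hz x)).1 (hU x)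
    rw [mem_C10_iff (hz x), and_iff_left hF, and_iff_left hS, isSkew_iff]
  · refine forall_congr' fun x ↦ ?_
    obtain ⟨hS, hF⟩ := (mem_C9_sup_C10_iff (hz x)).1 (hU x)
    rw [mem_C9_iff (hz x), and_iff_left hF, and_iff_left hS, isSymm_iff]
  · refine forall_congr' fun x ↦ ?_
    obtain ⟨hS, hF⟩ := (mem_C5to8_iff (hn x) (hz x)).1 (hU x)
    rw [mem_C5_sup_C8_iff (hn x) (hz x), and_iff_left hF, and_iff_left hS, isSkew_iff]
  · refine forall_congr' fun x ↦ ?_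
    obtain ⟨hS, hF⟩ := (mem_C5to8_iff (hn x) (hz x)).1 (hU x)
    rw [mem_C6_sup_C7_iff (hn x) (hz x), and_iff_left hF, and_iff_left hS, isSymm_iff]
  · refine forall_congr' fun x ↦ ?_
    obtain ⟨hS, hF⟩ := (mem_C5_sup_C8_iff (hn x) (hz x)).1 (hU x)
    rw [mem_C8_iff (hz x), and_iff_left hF, and_iff_right hS]
  · refine forall_congr' fun x ↦ ?_
    obtain ⟨hS, hF⟩ := (mem_C5_sup_C8_iff (hn x) (hz x)).1 (hU x)
    rw [mem_C5_iff (hn x) (hz x), and_iff_left hF]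
  · refine forall_congr' fun x ↦ ?_
    obtain ⟨hS, hF⟩ := (mem_C6_sup_C7_iff (hn x) (hz x)).1 (hU x)
    rw [mem_C6_iff (hn x) (hz x), and_iff_left hF]
  · refine forall_congr' fun x ↦ ?_
    obtain ⟨hS, hF⟩ := (mem_C6_sup_C7_iff (hn x) (hz x)).1 (hU x)
    rw [mem_C7_iff (hz x), and_iff_left hF, and_iff_right hS]
  · rw [isNormal_iff]
    refine forall_congr' fun x ↦ ?_
    rw [mem_C5to8_iff (hn x) (hz x), (r x).normal_iff (hz x)]
    rfl
  · rw [IsAlmostCokahler, dEtaEq_iff, dPhiEq_iff, ← forall_and]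
    refine forall_congr' fun x ↦ ?_
    have := (r x).almostCokahler_iff (hz x)
    simp only [Pi.zero_apply, mul_zero, zero_mul]
    rw [this, mem_C9_iff (hz x)]
    rfl
  · rw [IsQuasiSasakian, isNormal_iff, dPhiEq_iff, ← forall_and]
    refine forall_congr' fun x ↦ ?_
    have := (r x).quasiSasakian_iff (hz x)
    simp only [Pi.zero_apply, mul_zero, zero_mul]
    rw [this, mem_C6_sup_C7_iff (hn x) (hz x)]
    rfl
  · have key (x : M) := (r x).mem_C5_iff_F (hn x) (hz x)
    have h1 (β : M → ℝ) : (s.IsNormal ∧ s.DEtaEq 0 ∧ s.DPhiEq β) ↔ ∀ x,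
        (∀ X, s.S x X = β x • s.φ x X) ∧ ∀ X, s.nablaξφ x X = 0 := by
      rw [isNormal_iff, dEtaEq_iff, dPhiEq_iff, ← forall_and, ← forall_and]
      refine forall_congr' fun x ↦ ?_
      have := (r x).betaKenmotsu_iff (hz x) (β x)
      simp only [Pi.zero_apply, mul_zero, zero_mul]
      exact this
    have h2 : s.IsBetaKenmotsu ↔ ∃ β, s.IsNormal ∧ s.DEtaEq 0 ∧ s.DPhiEq β := by
      simp only [IsBetaKenmotsu, exists_and_left]
    simp_rw [h2, h1]
    -- The function `β` is assembled from pointwise scalars by choice; no regularity is demanded of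
    -- it.
    rw [← Classical.skolem (p := fun x (c : ℝ) ↦
      (∀ X, s.S x X = c • s.φ x X) ∧ ∀ X, s.nablaξφ x X = 0)]
    refine forall_congr' fun x ↦ ?_
    rw [exists_and_right]
    exact key x
  · have key (x : M) := (r x).mem_C6_iff_F (hn x) (hz x)
    have h1 (β : M → ℝ) : (s.IsQuasiSasakian ∧ s.DEtaEq β) ↔ ∀ x,
        (∀ X, s.S x X = β x • (X - s.η x X • s.ξ x)) ∧ ∀ X, s.nablaξφ x X = 0 := by
      rw [IsQuasiSasakian, isNormal_iff, dEtaEq_iff, dPhiEq_iff, ← forall_and, ← forall_and]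
      refine forall_congr' fun x ↦ ?_
      have := (r x).alphaSasakian_iff (hz x) (β x)
      simp only [Pi.zero_apply, mul_zero, zero_mul]
      exact this
    have h2 : s.IsAlphaSasakian ↔ ∃ β, s.IsQuasiSasakian ∧ s.DEtaEq β := by
      simp only [IsAlphaSasakian, exists_and_left]
    simp_rw [h2, h1]
    rw [← Classical.skolem (p := fun x (c : ℝ) ↦
      (∀ X, s.S x X = c • (X - s.η x X • s.ξ x)) ∧ ∀ X, s.nablaξφ x X = 0)]
    refine forall_congr' fun x ↦ ?_
    rw [exists_and_right]
    exact key x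
  · refine forall_congr' fun x ↦ ?_
    rw [mem_C5_iff (hn x) (hz x), and_comm]
    refine and_congr_left fun hS ↦ ?_
    -- A multiple of `φ` commutes with `φ`, so `F = 0` may be traded for `h = 0`.
    have hS' := LinearStructure.Represents.comm_of_smul_φ (a := s.linAt x)
      (S := (s.S x).toLinearMap) (ContinuousLinearMap.ext_iff.1 hS)
    rw [h_eq_zero_iff]
    exact (r x).F_eq_zero_iff_comm hS'.2
  · refine forall_congr' fun x ↦ ?_
    -- The coefficient is stated through `δΦ(ξ)`, which equals `tr S`.
    have ht : (s.linAt x).deltaPhi (s.nablaPhi x) (s.ξ x) = tr (s.S x) :=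
      (s.linAt x).deltaPhi_ξ_eq (r x).mem_CV (r x).apply_ξ
    rw [mem_C6_iff (hn x) (hz x), and_comm, ht]
    refine and_congr_left fun hS ↦ ?_
    have hS' := LinearStructure.Represents.comm_of_smul_proj (a := s.linAt x)
      (S := (s.S x).toLinearMap) hS
    rw [h_eq_zero_iff]
    exact (r x).F_eq_zero_iff_comm hS'.2
  · refine forall_congr' fun x ↦ ?_
    rw [mem_C7_iff (hz x), and_comm, isSymm_iff, and_assoc]
    constructor
    · rintro ⟨hF, hS, hc, ht⟩
      exact ⟨h_eq_zero_iff.2 (((r x).F_eq_zero_iff_comm hc).1 hF), hS,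
        (S_mem_EndComm_one_iff hS.1).1 hc, ht⟩
    · rintro ⟨hh, hS, hc, ht⟩
      have hc := (S_mem_EndComm_one_iff hS.1).2 hc
      exact ⟨((r x).F_eq_zero_iff_comm hc).2 (h_eq_zero_iff.1 hh), hS, hc, ht⟩
  · refine forall_congr' fun x ↦ ?_
    rw [mem_C8_iff (hz x), and_comm, isSkew_iff, and_assoc]
    constructor
    · rintro ⟨hF, hS, hc, ht⟩
      exact ⟨h_eq_zero_iff.2 (((r x).F_eq_zero_iff_comm hc).1 hF), hS,
        (S_mem_EndComm_one_iff hS.1).1 hc, ht⟩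
    · rintro ⟨hh, hS, hc, ht⟩
      have hc := (S_mem_EndComm_one_iff hS.1).2 hc
      exact ⟨((r x).F_eq_zero_iff_comm hc).2 (h_eq_zero_iff.1 hh), hS, hc, ht⟩
  · refine forall_congr' fun x ↦ ?_
    rw [mem_C9_iff (hz x), and_comm, isSymm_iff]
    constructor
    · rintro ⟨hF, hS, hc⟩
      exact ⟨h_eq_S_iff.2 (((r x).F_eq_zero_iff_anti hc).1 hF), hS,
        (S_mem_EndComm_neg_one_iff hS.1).1 hc⟩
    · rintro ⟨hh, hS, hc⟩
      have hc := (S_mem_EndComm_neg_one_iff hS.1).2 hc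
      exact ⟨((r x).F_eq_zero_iff_anti hc).2 (h_eq_S_iff.1 hh), hS, hc⟩
  · refine forall_congr' fun x ↦ ?_
    rw [mem_C10_iff (hz x), and_comm, isSkew_iff]
    constructor
    · rintro ⟨hF, hS, hc⟩
      exact ⟨h_eq_S_iff.2 (((r x).F_eq_zero_iff_anti hc).1 hF), hS,
        (S_mem_EndComm_neg_one_iff hS.1).1 hc⟩
    · rintro ⟨hh, hS, hc⟩
      have hc := (S_mem_EndComm_neg_one_iff hS.1).2 hc
      exact ⟨((r x).F_eq_zero_iff_anti hc).2 (h_eq_S_iff.1 hh), hS, hc⟩
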